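/- Let $M$ be a nonempty smooth manifold (Hausdorff, second countable, without boundary, of pure dimension $n\ge 3$, not necessarily compact or connected). Let $\mathrm{Metr}(M)$ be the set of smooth Riemannian metrics on $M$. For $g\in\mathrm{Metr}(M)$ let $\mu_g$ be its volume measure and $\mathrm{scal}_g$ its scalar curvature, put $p=\frac{2n}{n-2}$ and $a_n=\frac{4(n-1)}{n-2}$, and define the Yamabe constant $$Y_M(g)=\inf\left\{\frac{1}{\|v\|_{L^p(g)}^2}\int_M\left(a_n|dv|_g^2+\mathrm{scal}_g\,v^2\right)d\mu_g\ :\ v\in C^\infty_c(M,\mathbb R_{\ge0})\setminus\{0\}\right\}\in\mathbb R\cup\{-\infty\}.$$ Equip $\mathrm{Metr}(M)$ with the fine (Whitney) $C^2$-topology: a basis is given by the sets $\mathcal N_U=\{h\in\mathrm{Metr}(M) : j^2_xh\in U\text{ for all }x\in M\}$, where $U$ ranges over the open subsets of the total space of the $2$-jet bundle $J^2\mathrm{Sym}^2_+T^*M$ of the bundle of positive definite symmetric bilinear forms on the tangent spaces of $M$, and $j^2_xh$ is the $2$-jet of $h$ at $x$. Then the Yamabe map $Y_M:\mathrm{Metr}(M)\to\mathbb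 R\cup\{-\infty\}$, $g\mapsto Y_M(g)$, is continuous. (Here $\mathbb R\cup\{-\infty\}$ carries the usual topology, in which the sets $[-\infty,c)$, $c\in\mathbb R$, form a neighbourhood basis of $-\infty$.) -/

import Mathlib

open scoped Manifold ContDiff Topology

noncomputable section

namespace Yamabe

/-- The model space `ℝⁿ` of an `n`-manifold. -/
abbrev Coord (n : ℕ) : Type := EuclideanSpace ℝ (Fin n)

/-- Bilinear forms on `ℝⁿ`. -/
abbrev Form (n : ℕ) : Type := Coord n →L[ℝ] Coord n →L[ℝ] ℝ

/-- The `i`-th standard basis vector of `ℝⁿ`. -/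
def stdVec (n : ℕ) (i : Fin n) : Coord n := EuclideanSpace.single i (1 : ℝ)

section Local

/-! Differential geometry of a matrix-valued function `G = (g_{ij})` on (a part of) `ℝⁿ`. -/

variable {n : ℕ}

/-- The partial derivative `∂ᵢ f (y)`. -/
def pd (i : Fin n) (f : Coord n → ℝ) (y : Coord n) : ℝ := fderiv ℝ f y (stdVec n i)

/-- `Γᵏ_{ij} = ½ ∑_l g^{kl} (∂ᵢ g_{jl} + ∂ⱼ g_{il} - ∂_l g_{ij})`. -/
def christoffel (G : Coord n → Matrix (Fin n) (Fin n) ℝ) (k i j : Fin n) (y : Coord n) : ℝ :=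
  (1 / 2) * ∑ l, (G y)⁻¹ k l *
    (pd i (fun z => G z j l) y + pd j (fun z => G z i l) y - pd l (fun z => G z i j) y)

/-- `Ric_{jk} = ∑ᵢ (∂ᵢ Γⁱ_{jk} - ∂ₖ Γⁱ_{ij}) + ∑_{i,p} (Γⁱ_{ip} Γᵖ_{jk} - Γⁱ_{kp} Γᵖ_{ij})`. -/
def coordRicci (G : Coord n → Matrix (Fin n) (Fin n) ℝ) (j k : Fin n) (y : Coord n) : ℝ :=
  ∑ i, (pd i (christoffel G i j k) y - pd k (christoffel G i i j) y) +
    ∑ i, ∑ p, (christoffel G i i p y * christoffel G p j k y -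
      christoffel G i k p y * christoffel G p i j y)

/-- `scal = ∑_{j,k} g^{jk} Ric_{jk}` (positive for round spheres). -/
def coordScal (G : Coord n → Matrix (Fin n) (Fin n) ℝ) (y : Coord n) : ℝ :=
  ∑ j, ∑ k, (G y)⁻¹ j k * coordRicci G j k y

end Local

section Manifold

variable (n : ℕ) (M : Type*) [TopologicalSpace M] [ChartedSpace (Coord n) M]

/-- (Not necessarily continuous) fields of bilinear forms on the tangent spaces of `M`. -/
abbrev FormField : Type _ :=
  ∀ x : M, TangentSpace (𝓡 n) x →L[ℝ] TangentSpace (𝓡 n) x →L[ℝ] ℝ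

/-- The set of smooth Riemannian metrics on the `n`-manifold `M`. -/
abbrev Metr [IsManifold (𝓡 n) ∞ M] : Type _ :=
  Bundle.ContMDiffRiemannianMetric (𝓡 n) ∞ (Coord n) (fun x : M => TangentSpace (𝓡 n) x)

variable {n M}

/-- The matrix `(g(vᵢ, vⱼ))` of `g` at `x` for vectors `vᵢ ∈ T_xM`. -/
def gram (g : FormField n M) (x : M) (v : Fin n → TangentSpace (𝓡 n) x) :
    Matrix (Fin n) (Fin n) ℝ :=
  Matrix.of fun i j => g x (v i) (v j)

/-- The coordinate vector `∂ᵢ ∈ T_xM` of the chart `e` at the point `x = e⁻¹(y)`. -/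
def coordVec (e : OpenPartialHomeomorph M (Coord n)) (y : Coord n) (i : Fin n) :
    TangentSpace (𝓡 n) (e.symm y) :=
  mfderiv (𝓡 n) (𝓡 n) e.symm y (stdVec n i)

/-- The coordinate expression `(g_{ij})` of `g` in the chart `e`, as a function on `ℝⁿ`.
Only its values on the open set `e.target` matter. -/
def coordForm (g : FormField n M) (e : OpenPartialHomeomorph M (Coord n)) (y : Coord n) :
    Matrix (Fin n) (Fin n) ℝ :=
  gram g (e.symm y) (coordVec e y)

/-! ### The Yamabe constant -/

/-- The scalar curvature `scal_g(x)`, computed in the preferred chart at `x`. -/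
def scal (g : FormField n M) (x : M) : ℝ :=
  coordScal (coordForm g (chartAt (Coord n) x)) (chartAt (Coord n) x x)

/-- The squared norm `|α|_g² = ∑ g^{ij} α(bᵢ) α(bⱼ)` of a cotangent vector `α` at `x`, for the basis
`(bᵢ)` of `T_xM` given by the identification of `T_xM` with `ℝⁿ`. -/
def cotangentNormSq (g : FormField n M) (x : M) (α : TangentSpace (𝓡 n) x →L[ℝ] ℝ) : ℝ :=
  let b : Fin n → TangentSpace (𝓡 n) x := stdVec n
  ∑ i, ∑ j, (gram g x b)⁻¹ i j * α (b i) * α (b j)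

/-- The volume measure of `g` on the domain of the chart `e`: the measure `√(det g_{ij}) dy` on
`e.target`, transported to `M`. -/
def chartVolume [MeasurableSpace M] (g : FormField n M)
    (e : OpenPartialHomeomorph M (Coord n)) : MeasureTheory.Measure M :=
  (((MeasureTheory.volume : MeasureTheory.Measure (Coord n)).restrict e.target).withDensity
    fun y => ENNReal.ofReal (Real.sqrt (coordForm g e y).det)).map e.symm

/-- The Riemannian volume measure `μ_g`. The measures `chartVolume g e` agree on overlaps of chart
domains, so that their least upper bound is the measure that restricts to `chartVolume g e` on the
domain of every chart `e`. -/
def riemVolume [MeasurableSpace M] (g : FormField n M) : MeasureTheory.Measure M :=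
  ⨆ e ∈ atlas (Coord n) M, chartVolume g e

variable (n M) in
/-- The set `C^∞_c(M, ℝ_{≥0}) ∖ {0}` of test functions. -/
def TestFun : Type _ :=
  {v : M → ℝ // ContMDiff (𝓡 n) 𝓘(ℝ, ℝ) ∞ v ∧ HasCompactSupport v ∧ (∀ x, 0 ≤ v x) ∧ v ≠ 0}

/-- The norm `‖v‖_{L^p(g)}` of a nonnegative function, `p = 2n/(n-2)`. -/
def lpNorm [MeasurableSpace M] (g : FormField n M) (v : M → ℝ) : ℝ :=
  (∫ x, v x ^ (2 * (n : ℝ) / ((n : ℝ) - 2)) ∂(riemVolume g)) ^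
    (1 / (2 * (n : ℝ) / ((n : ℝ) - 2)))

/-- The Yamabe functional
`‖v‖_{L^p(g)}⁻² ∫ (a_n |dv|_g² + scal_g v²) dμ_g`, where `a_n = 4(n-1)/(n-2)`. -/
def yamabeFunctional [MeasurableSpace M] (g : FormField n M) (v : M → ℝ) : ℝ :=
  1 / lpNorm g v ^ 2 *
    ∫ x, (4 * ((n : ℝ) - 1) / ((n : ℝ) - 2) *
      cotangentNormSq g x (mfderiv (𝓡 n) 𝓘(ℝ, ℝ) v x) + scal g x * v x ^ 2) ∂(riemVolume g)

/-- The Yamabe map `g ↦ Y_M(g)`, with values in `ℝ ∪ {-∞} ⊆ [-∞, ∞]`. -/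
def yamabe [MeasurableSpace M] [IsManifold (𝓡 n) ∞ M] (g : Metr n M) : EReal :=
  ⨅ v : TestFun n M, ((yamabeFunctional g.inner v.1 : ℝ) : EReal)

/-! ### The space of `2`-jets of metrics and the fine `C²`-topology -/

/-- `h` is a smooth Riemannian metric on a neighbourhood of `x`. -/
def IsMetricNear (h : FormField n M) (x : M) [IsManifold (𝓡 n) ∞ M] : Prop :=
  ∀ᶠ y in 𝓝 x,
    ContMDiffAt (𝓡 n) ((𝓡 n).prod 𝓘(ℝ, Form n)) ∞
      (fun b => Bundle.TotalSpace.mk' (Form n)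
        (E := fun x : M => TangentSpace (𝓡 n) x →L[ℝ] TangentSpace (𝓡 n) x →L[ℝ] ℝ) b (h b)) y ∧
    (∀ v w, h y v w = h y w v) ∧ (∀ v, v ≠ 0 → 0 < h y v v)

/-- Coordinates of `2`-jets: a point of `ℝⁿ` and the values of `g_{ij}`, `∂ₖ g_{ij}` and
`∂ₗ∂ₖ g_{ij}`. -/
abbrev JetCoord (n : ℕ) : Type :=
  Coord n × (Fin n → Fin n → ℝ) × (Fin n → Fin n → Fin n → ℝ) ×
    (Fin n → Fin n → Fin n → Fin n → ℝ)

/-- The coordinates of the `2`-jet of `h` at `x` with respect to the chart `e`. -/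
def coordJet (h : FormField n M) (x : M) (e : OpenPartialHomeomorph M (Coord n)) : JetCoord n :=
  (e x,
    fun i j => coordForm h e (e x) i j,
    fun k i j => pd k (fun y => coordForm h e y i j) (e x),
    fun l k i j => pd l (pd k (fun y => coordForm h e y i j)) (e x))

variable (n M) in
/-- A point of `M` together with a metric defined near that point. -/
structure PointedMetric [IsManifold (𝓡 n) ∞ M] where
  base : M
  form : FormField n M
  isMetricNear : IsMetricNear form base

variable (n M) in
/-- Equality of `2`-jets: same base point, and the same value and first and second derivatives
there in charts. -/
def jetSetoid [IsManifold (𝓡 n) ∞ M] : Setoid (PointedMetric n M) where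
  r p q := p.base = q.base ∧ ∀ e ∈ atlas (Coord n) M, p.base ∈ e.source →
    coordJet p.form p.base e = coordJet q.form q.base e
  iseqv :=
    { refl := fun _ => ⟨rfl, fun _ _ _ => rfl⟩
      symm := fun h => ⟨h.1.symm, fun e he hx => (h.2 e he (h.1 ▸ hx)).symm⟩
      trans := fun h k =>
        ⟨h.1.trans k.1, fun e he hx => (h.2 e he hx).trans (k.2 e he (h.1 ▸ hx))⟩ }

variable (n M) in
/-- The total space of the `2`-jet bundle `J² Sym²₊ T*M`: `2`-jets `j²ₓh` of metrics `h` that are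
defined near the point `x`. -/
def JetSpace [IsManifold (𝓡 n) ∞ M] : Type _ := Quotient (jetSetoid n M)

/-- The projection of the `2`-jet bundle to `M`. -/
def JetSpace.base [IsManifold (𝓡 n) ∞ M] (η : JetSpace n M) : M :=
  Quotient.lift (s := jetSetoid n M) PointedMetric.base (fun _ _ h => h.1) η

open Classical in
/-- The bundle chart `j²ₓh ↦ (e x, h_{ij}, ∂ₖ h_{ij}, ∂ₗ∂ₖ h_{ij})` of the `2`-jet bundle over the
domain of the chart `e` of `M` (with the value `0` elsewhere). -/
def JetSpace.chart [IsManifold (𝓡 n) ∞ M] (e : atlas (Coord n) M) (η : JetSpace n M) :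
    JetCoord n :=
  Quotient.lift (s := jetSetoid n M)
    (fun p => if p.base ∈ e.1.source then coordJet p.form p.base e.1 else 0)
    (fun p q h => by
      by_cases hp : p.base ∈ e.1.source
      · have hq : q.base ∈ e.1.source := h.1 ▸ hp
        simpa [hp, hq] using h.2 e.1 e.2 hp
      · have hq : q.base ∉ e.1.source := h.1 ▸ hp
        simp [hp, hq]) η

/-- The topology of the `2`-jet bundle. A set `U` of jets is open iff, for every chart `e`, its part
over the domain of `e` is the preimage of an open set under the bundle chart given by `e`. -/
instance JetSpace.topology [IsManifold (𝓡 n) ∞ M] : TopologicalSpace (JetSpace n M) :=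
  ⨆ e : atlas (Coord n) M,
    TopologicalSpace.coinduced
      (Subtype.val : {η : JetSpace n M // η.base ∈ e.1.source} → JetSpace n M)
      (TopologicalSpace.induced (fun η => JetSpace.chart e η.1) inferInstance)

/-- A Riemannian metric on `M` is a metric near each point. -/
theorem Metr.isMetricNear [IsManifold (𝓡 n) ∞ M] (g : Metr n M) (x : M) :
    IsMetricNear (n := n) (M := M) g.inner x :=
  Filter.Eventually.of_forall fun y => ⟨g.contMDiff y, g.symm y, g.pos y⟩

/-- The `2`-jet `j²ₓg` of a metric `g` at `x`. -/
def jet [IsManifold (𝓡 n) ∞ M] (g : Metr n M) (x : M) : JetSpace n M :=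
  Quotient.mk (jetSetoid n M) ⟨x, g.inner, g.isMetricNear x⟩

variable (n M) in
/-- The fine (Whitney) `C²`-topology on the set of metrics: the sets
`N_U = {h | graph(j²h) ⊆ U}`, for `U` open in the total space of the `2`-jet bundle, are a basis. -/
@[reducible] def fineC2Topology [IsManifold (𝓡 n) ∞ M] : TopologicalSpace (Metr n M) :=
  TopologicalSpace.generateFrom
    {N | ∃ U : Set (JetSpace n M), IsOpen U ∧ N = {h : Metr n M | Set.range (jet h) ⊆ U}}

end Manifold

end Yamabe

end

/-!
The Yamabe map is the infimum over test functions `v` of the quotients `Q_g(v) = E_g(v) / N_g(v)²`,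
where `E_g` is the energy and `N_g` the `Lᵖ`-norm, `p = 2n/(n-2)`. Continuity amounts to
semicontinuity from both sides.

*Metrics near `g`.* For a positive continuous function `κ`, the metrics `h` whose induced norms of
covectors, scalar curvature and volume density differ from those of `g` by less than `κ(x)` at each
point `x` form a neighbourhood of `g` in the fine `C²`-topology (`eventually_closeAt`). These
conditions do not depend on charts, and in every chart they are open conditions on the coordinates
of the `2`-jet. For the scalar curvature this rests on its invariance under coordinate changes
(`IsPullback.coordScal_pullback`): the connection matrices transform by a gauge transformation,
since the gauge transform is symmetric and metric and these two properties characterize the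
Levi-Civita connection; hence the curvature matrices transform tensorially. Invariance and the
change of variables formula also give that `scal_g` and `|dv|_g²` are continuous functions on `M`
and that the volume measure is locally finite; the volume measures of two metrics differ by a
continuous density.

*Upper semicontinuity.* For a fixed `v`, the quotient `Q_h(v)` is as close to `Q_g(v)` as desired if
`h` is `δ`-close to `g` for a small constant `δ` (`eventually_yamabeFunctional_lt`).

*Lower semicontinuity.* The difficulty is that `∫ κ |dv|_g²` has to be controlled by `E_g(v)` and
`N_g(v)²`, uniformly in `v`, although `scal_g` may be unbounded. The idea is to test the Yamabe
constant of `g` with `(1 - κ) v` instead of `v`, where `κ = ∑ cᵢ ρᵢ²` for a locally finite family of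
cutoff functions `ρᵢ`. Since `|dκ|²` is of the order of `κ ∑ cᵢ |dρᵢ|²`, this gains the term
`aₙ ∫ κ |dv|_g²`:
`E_g((1 - κ) v) + aₙ ∫ κ |dv|_g² ≤ E_g(v) + ∑ cᵢ ∫ fᵢ v²`
with compactly supported functions `fᵢ` that depend only on `g` and `ρᵢ`. By Hölder's inequality
`∫ fᵢ v² ≤ ‖fᵢ‖_{n/2} N_g(v)²`, so that the error is at most `δ N_g(v)²` if the `cᵢ` decay fast
enough (`CutoffFamily.energy_localization`). For metrics `h` that are `κ/3`-close to `g` the gain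
absorbs the difference `E_h(v) - E_g(v)`, so that a lower bound of `Q_g` gives almost the same lower
bound of `Q_h` (`eventually_le_yamabeFunctional`).
-/

noncomputable section

namespace Yamabe

section LocalGeometry

open Matrix

variable {n : ℕ}

/-! ### Partial derivatives of functions and matrix-valued functions -/

/-- The entrywise partial derivative `∂ᵢ A` of a matrix-valued function. -/
def mpd (i : Fin n) (A : Coord n → Matrix (Fin n) (Fin n) ℝ) (y : Coord n) :
    Matrix (Fin n) (Fin n) ℝ :=
  Matrix.of fun j k => pd i (fun z => A z j k) y

/-- The matrix-valued function `A` has smooth entries at every point of `Ω`. -/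
def MatSmooth (A : Coord n → Matrix (Fin n) (Fin n) ℝ) (Ω : Set (Coord n)) : Prop :=
  ∀ j k, ∀ y ∈ Ω, ContDiffAt ℝ ∞ (fun z => A z j k) y

/-- The Jacobian matrix `(∂ᵢ τᵃ)`. -/
def jac (τ : Coord n → Coord n) (y : Coord n) : Matrix (Fin n) (Fin n) ℝ :=
  Matrix.of fun a i => pd i (fun z => τ z a) y

theorem pd_congr {f g : Coord n → ℝ} {y : Coord n} (h : f =ᶠ[𝓝 y] g) (i : Fin n) :
    pd i f y = pd i g y := by
  simp only [pd, h.fderiv_eq]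

theorem contDiffAt_pd {f : Coord n → ℝ} {y : Coord n} (hf : ContDiffAt ℝ ∞ f y) (i : Fin n) :
    ContDiffAt ℝ ∞ (pd i f) y :=
  (hf.fderiv_right (m := ∞) (by simp)).clm_apply contDiffAt_const

theorem differentiableAt_of_contDiffAt_infty {f : Coord n → ℝ} {y : Coord n}
    (hf : ContDiffAt ℝ ∞ f y) : DifferentiableAt ℝ f y :=
  hf.differentiableAt (by simp)

theorem pd_pd_comm {f : Coord n → ℝ} {y : Coord n} (hf : ContDiffAt ℝ ∞ f y) (i j : Fin n) :
    pd i (pd j f) y = pd j (pd i f) y := by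
  have hd : DifferentiableAt ℝ (fderiv ℝ f) y :=
    (hf.fderiv_right (m := ∞) (by simp)).differentiableAt (by simp)
  have key : ∀ k l : Fin n, pd k (pd l f) y =
      fderiv ℝ (fderiv ℝ f) y (stdVec n k) (stdVec n l) := by
    intro k l
    have : pd k (pd l f) y = fderiv ℝ (fun z => fderiv ℝ f z (stdVec n l)) y (stdVec n k) := rfl
    rw [this, fderiv_clm_apply hd (differentiableAt_const _)]
    simp
  rw [key, key]
  refine (hf.isSymmSndFDerivAt ?_) _ _
  rw [minSmoothness_of_isRCLikeNormedField]
  exact WithTop.coe_le_coe.2 le_top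

theorem coord_eq_sum (v : Coord n) : v = ∑ m, v m • stdVec n m := by
  ext k
  simp [stdVec, Finset.sum_apply, Pi.single_apply]

theorem fderiv_apply_coord {τ : Coord n → Coord n} {y : Coord n} (hτ : DifferentiableAt ℝ τ y)
    (v : Coord n) (a : Fin n) : fderiv ℝ τ y v a = fderiv ℝ (fun z => τ z a) y v := by
  have h := ((EuclideanSpace.proj a : Coord n →L[ℝ] ℝ).hasFDerivAt.comp y hτ.hasFDerivAt).fderiv
  have h2 : fderiv ℝ (fun z => τ z a) y =
      (EuclideanSpace.proj a : Coord n →L[ℝ] ℝ).comp (fderiv ℝ τ y) := h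
  rw [h2]; rfl

theorem fderiv_stdVec_eq_sum {τ : Coord n → Coord n} {y : Coord n} (hτ : DifferentiableAt ℝ τ y)
    (i : Fin n) : fderiv ℝ τ y (stdVec n i) = ∑ m, jac τ y m i • stdVec n m := by
  conv_lhs => rw [coord_eq_sum (fderiv ℝ τ y (stdVec n i))]
  refine Finset.sum_congr rfl fun m _ => ?_
  rw [fderiv_apply_coord hτ]; rfl

/-- The chain rule for partial derivatives. -/
theorem pd_comp {f : Coord n → ℝ} {τ : Coord n → Coord n} {y : Coord n}
    (hf : DifferentiableAt ℝ f (τ y)) (hτ : DifferentiableAt ℝ τ y) (i : Fin n) :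
    pd i (fun z => f (τ z)) y = ∑ m, jac τ y m i * pd m f (τ y) := by
  have h : fderiv ℝ (fun z => f (τ z)) y = (fderiv ℝ f (τ y)).comp (fderiv ℝ τ y) :=
    fderiv_comp y hf hτ
  simp only [pd, h, ContinuousLinearMap.comp_apply, fderiv_stdVec_eq_sum hτ, map_sum, map_smul,
    smul_eq_mul]

theorem pd_add {f g : Coord n → ℝ} {y : Coord n} (hf : DifferentiableAt ℝ f y)
    (hg : DifferentiableAt ℝ g y) (i : Fin n) :
    pd i (fun z => f z + g z) y = pd i f y + pd i g y := by
  simp only [pd]; rw [fderiv_fun_add hf hg]; rfl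

theorem pd_sub {f g : Coord n → ℝ} {y : Coord n} (hf : DifferentiableAt ℝ f y)
    (hg : DifferentiableAt ℝ g y) (i : Fin n) :
    pd i (fun z => f z - g z) y = pd i f y - pd i g y := by
  simp only [pd]; rw [fderiv_fun_sub hf hg]; rfl

theorem pd_mul {f g : Coord n → ℝ} {y : Coord n} (hf : DifferentiableAt ℝ f y)
    (hg : DifferentiableAt ℝ g y) (i : Fin n) :
    pd i (fun z => f z * g z) y = pd i f y * g y + f y * pd i g y := by
  simp only [pd]; rw [fderiv_fun_mul hf hg]; simp; ring

theorem pd_sum {ι : Type*} {s : Finset ι} {f : ι → Coord n → ℝ} {y : Coord n}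
    (hf : ∀ a ∈ s, DifferentiableAt ℝ (f a) y) (i : Fin n) :
    pd i (fun z => ∑ a ∈ s, f a z) y = ∑ a ∈ s, pd i (f a) y := by
  simp only [pd]; rw [fderiv_fun_sum hf]; simp

theorem pd_const_mul {f : Coord n → ℝ} {y : Coord n} (hf : DifferentiableAt ℝ f y) (c : ℝ)
    (i : Fin n) : pd i (fun z => c * f z) y = c * pd i f y := by
  simp only [pd]; rw [fderiv_const_mul hf]; rfl

section Smooth

variable {Ω : Set (Coord n)} {A B : Coord n → Matrix (Fin n) (Fin n) ℝ} {y : Coord n}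

theorem MatSmooth.diff (hA : MatSmooth A Ω) (hy : y ∈ Ω) (j k : Fin n) :
    DifferentiableAt ℝ (fun z => A z j k) y :=
  differentiableAt_of_contDiffAt_infty (hA j k y hy)

theorem MatSmooth.mul (hA : MatSmooth A Ω) (hB : MatSmooth B Ω) :
    MatSmooth (fun z => A z * B z) Ω := by
  intro j k y hy
  simp only [Matrix.mul_apply]
  exact ContDiffAt.sum fun i _ => (hA j i y hy).mul (hB i k y hy)

theorem MatSmooth.add (hA : MatSmooth A Ω) (hB : MatSmooth B Ω) :
    MatSmooth (fun z => A z + B z) Ω := fun j k y hy => (hA j k y hy).add (hB j k y hy)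

theorem MatSmooth.transpose (hA : MatSmooth A Ω) : MatSmooth (fun z => (A z)ᵀ) Ω :=
  fun j k => hA k j

theorem MatSmooth.mpd (hA : MatSmooth A Ω) (i : Fin n) : MatSmooth (mpd i A) Ω :=
  fun j k y hy => contDiffAt_pd (hA j k y hy) i

theorem MatSmooth.sum {ι : Type*} {s : Finset ι} {A : ι → Coord n → Matrix (Fin n) (Fin n) ℝ}
    (hA : ∀ a ∈ s, MatSmooth (A a) Ω) : MatSmooth (fun z => ∑ a ∈ s, A a z) Ω := by
  intro j k y hy
  simp only [Matrix.sum_apply]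
  exact ContDiffAt.sum fun a ha => hA a ha j k y hy

theorem MatSmooth.smul {f : Coord n → ℝ} (hf : ∀ y ∈ Ω, ContDiffAt ℝ ∞ f y)
    (hA : MatSmooth A Ω) : MatSmooth (fun z => f z • A z) Ω :=
  fun j k y hy => (hf y hy).mul (hA j k y hy)

theorem contDiffAt_det (hA : MatSmooth A Ω) (hy : y ∈ Ω) :
    ContDiffAt ℝ ∞ (fun z => (A z).det) y := by
  simp only [Matrix.det_apply]
  refine ContDiffAt.sum fun σ _ => ?_
  refine ContDiffAt.const_smul _ ?_
  exact contDiffAt_prod fun i _ => hA _ _ y hy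

theorem MatSmooth.inv (hA : MatSmooth A Ω) (hdet : ∀ y ∈ Ω, (A y).det ≠ 0) :
    MatSmooth (fun z => (A z)⁻¹) Ω := by
  intro j k y hy
  have h : (fun z => (A z)⁻¹ j k) = fun z => ((A z).det)⁻¹ * (A z).adjugate j k := by
    funext z
    rw [Matrix.inv_def, Matrix.smul_apply, Ring.inverse_eq_inv', smul_eq_mul]
  rw [h]
  refine ((contDiffAt_det hA hy).inv (hdet y hy)).mul ?_
  simp only [Matrix.adjugate_apply]
  refine contDiffAt_det (Ω := Ω) (A := fun z => (A z).updateRow k (Pi.single j 1)) ?_ hy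
  intro a b y hy
  by_cases hak : a = k
  · subst hak; simp only [Matrix.updateRow_self]; exact contDiffAt_const
  · simp only [Matrix.updateRow_ne hak]; exact hA a b y hy

theorem mpd_congr (h : A =ᶠ[𝓝 y] B) (i : Fin n) : mpd i A y = mpd i B y := by
  ext j k
  exact pd_congr (h.mono fun z hz => by simp only [hz]) i

theorem mpd_mul (hA : MatSmooth A Ω) (hB : MatSmooth B Ω) (hy : y ∈ Ω) (i : Fin n) :
    mpd i (fun z => A z * B z) y = mpd i A y * B y + A y * mpd i B y := by
  ext j k
  simp only [mpd, Matrix.of_apply, Matrix.add_apply, Matrix.mul_apply]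
  rw [pd_sum (f := fun a z => A z j a * B z a k)
    (fun a _ => (hA.diff hy j a).fun_mul (hB.diff hy a k)), ← Finset.sum_add_distrib]
  exact Finset.sum_congr rfl fun a _ => pd_mul (hA.diff hy _ _) (hB.diff hy _ _) i

theorem mpd_add (hA : MatSmooth A Ω) (hB : MatSmooth B Ω) (hy : y ∈ Ω) (i : Fin n) :
    mpd i (fun z => A z + B z) y = mpd i A y + mpd i B y := by
  ext j k
  exact pd_add (hA.diff hy _ _) (hB.diff hy _ _) i

theorem mpd_transpose (i : Fin n) : mpd i (fun z => (A z)ᵀ) y = (mpd i A y)ᵀ := rfl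

theorem mpd_sum {ι : Type*} {s : Finset ι} {A : ι → Coord n → Matrix (Fin n) (Fin n) ℝ}
    (hA : ∀ a ∈ s, MatSmooth (A a) Ω) (hy : y ∈ Ω) (i : Fin n) :
    mpd i (fun z => ∑ a ∈ s, A a z) y = ∑ a ∈ s, mpd i (A a) y := by
  ext j k
  simp only [mpd, Matrix.of_apply, Matrix.sum_apply]
  exact pd_sum (fun a ha => (hA a ha).diff hy _ _) i

theorem mpd_smul {f : Coord n → ℝ} (hf : ∀ y ∈ Ω, ContDiffAt ℝ ∞ f y)
    (hA : MatSmooth A Ω) (hy : y ∈ Ω) (i : Fin n) :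
    mpd i (fun z => f z • A z) y = pd i f y • A y + f y • mpd i A y := by
  ext j k
  exact pd_mul (differentiableAt_of_contDiffAt_infty (hf y hy)) (hA.diff hy _ _) i

theorem mpd_comp {Ω' : Set (Coord n)} {τ : Coord n → Coord n} (hA : MatSmooth A Ω')
    (hτ : DifferentiableAt ℝ τ y) (hy : τ y ∈ Ω') (i : Fin n) :
    mpd i (fun z => A (τ z)) y = ∑ m, jac τ y m i • mpd m A (τ y) := by
  ext j k
  simp only [mpd, Matrix.of_apply, Matrix.sum_apply, Matrix.smul_apply, smul_eq_mul]
  exact pd_comp (f := fun z => A z j k) (hA.diff hy _ _) hτ i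

theorem mpd_mpd_comm (hA : MatSmooth A Ω) (hy : y ∈ Ω) (i j : Fin n) :
    mpd i (mpd j A) y = mpd j (mpd i A) y := by
  ext a b
  exact pd_pd_comm (hA a b y hy) i j

end Smooth

end LocalGeometry

section Curvature

open Matrix

variable {n : ℕ} {Ω Ω' : Set (Coord n)} {G : Coord n → Matrix (Fin n) (Fin n) ℝ} {y : Coord n}

/-! ### Invariance of the scalar curvature under coordinate changes -/

/-- The connection matrix `Aᵢ = (Γᵏ_{ij})_{k,j}` of the Levi-Civita connection. -/
def conn (G : Coord n → Matrix (Fin n) (Fin n) ℝ) (i : Fin n) (y : Coord n) :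
    Matrix (Fin n) (Fin n) ℝ :=
  Matrix.of fun k j => christoffel G k i j y

theorem contDiffAt_christoffel (hG : MatSmooth G Ω) (hdet : ∀ y ∈ Ω, (G y).det ≠ 0) (hy : y ∈ Ω)
    (k i j : Fin n) : ContDiffAt ℝ ∞ (christoffel G k i j) y := by
  unfold christoffel
  refine contDiffAt_const.mul (ContDiffAt.sum fun l _ => ?_)
  exact ((hG.inv hdet) k l y hy).mul (((contDiffAt_pd (hG j l y hy) i).add
    (contDiffAt_pd (hG i l y hy) j)).sub (contDiffAt_pd (hG i j y hy) l))

theorem MatSmooth.conn (hG : MatSmooth G Ω) (hdet : ∀ y ∈ Ω, (G y).det ≠ 0) (i : Fin n) :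
    MatSmooth (conn G i) Ω :=
  fun k j _ hy => contDiffAt_christoffel hG hdet hy k i j

/-- The Christoffel symbols with lowered index. -/
theorem mul_conn_apply (hdet : (G y).det ≠ 0) (i l j : Fin n) :
    (G y * conn G i y) l j = (1 / 2) *
      (pd i (fun z => G z j l) y + pd j (fun z => G z i l) y - pd l (fun z => G z i j) y) := by
  set w : Fin n → ℝ := fun l => (1 / 2) *
      (pd i (fun z => G z j l) y + pd j (fun z => G z i l) y - pd l (fun z => G z i j) y) with hw
  have h1 : ∀ k, conn G i y k j = ((G y)⁻¹ *ᵥ w) k := by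
    intro k
    simp only [conn, Matrix.of_apply, christoffel, Matrix.mulVec, dotProduct, hw, Finset.mul_sum]
    exact Finset.sum_congr rfl fun l _ => by ring
  have h2 : (G y * conn G i y) l j = (G y *ᵥ ((G y)⁻¹ *ᵥ w)) l := by
    simp only [Matrix.mul_apply, h1]
    rfl
  rw [h2, Matrix.mulVec_mulVec, Matrix.mul_nonsing_inv _ (isUnit_iff_ne_zero.2 hdet),
    Matrix.one_mulVec]

/-- The Levi-Civita connection is characterized by being symmetric and metric. -/
theorem eq_conn_of_symm_of_metric (hdet : (G y).det ≠ 0) (hsymm : (G y)ᵀ = G y)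
    {B : Fin n → Matrix (Fin n) (Fin n) ℝ} (hB : ∀ i j k, B i k j = B j k i)
    (hm : ∀ i, mpd i G y = (B i)ᵀ * G y + G y * B i) (i : Fin n) : B i = conn G i y := by
  set C : Fin n → Fin n → Fin n → ℝ := fun i l j => (G y * B i) l j with hC
  have hCs : ∀ i l j, C i l j = C j l i := by
    intro i l j
    simp only [hC, Matrix.mul_apply]
    exact Finset.sum_congr rfl fun k _ => by rw [hB]
  have hd : ∀ i l j, pd i (fun z => G z l j) y = C i j l + C i l j := by
    intro i l j
    have h1 : pd i (fun z => G z l j) y = (mpd i G y) l j := rfl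
    have h2 : (B i)ᵀ * G y = (G y * B i)ᵀ := by rw [Matrix.transpose_mul, hsymm]
    rw [h1, hm, h2]; rfl
  have key : G y * B i = G y * conn G i y := by
    ext l j
    rw [mul_conn_apply hdet, hd, hd, hd]
    have e1 : (G y * B i) l j = C i l j := rfl
    rw [e1, hCs i j l, hCs j i l, hCs i l j, hCs j l i, hCs l i j, hCs i l j]
    have := hCs l j i; have := hCs j l i; have := hCs l i j; have := hCs i j l
    linarith
  have hu := isUnit_iff_ne_zero.2 hdet
  calc B i = (G y)⁻¹ * (G y * B i) := by rw [Matrix.nonsing_inv_mul_cancel_left _ _ hu]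
    _ = conn G i y := by rw [key, Matrix.nonsing_inv_mul_cancel_left _ _ hu]

/-- The Levi-Civita connection is torsion-free. -/
theorem conn_symm (hs : ∀ᶠ z in 𝓝 y, (G z)ᵀ = G z) (i j k : Fin n) :
    conn G i y k j = conn G j y k i := by
  have hpds : ∀ i j k : Fin n, pd i (fun z => G z j k) y = pd i (fun z => G z k j) y := by
    intro i j k
    refine pd_congr (hs.mono fun z hz => ?_) i
    conv_lhs => rw [← hz]
    rfl
  simp only [conn, Matrix.of_apply, christoffel]
  congr 1
  refine Finset.sum_congr rfl fun l _ => ?_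
  rw [hpds l i j, add_comm (pd i _ y)]

/-- The Levi-Civita connection is compatible with the metric. -/
theorem conn_metric (hdet : (G y).det ≠ 0) (hsymm : (G y)ᵀ = G y)
    (hs : ∀ᶠ z in 𝓝 y, (G z)ᵀ = G z) (i : Fin n) :
    mpd i G y = (conn G i y)ᵀ * G y + G y * conn G i y := by
  have hpds : ∀ i j k : Fin n, pd i (fun z => G z j k) y = pd i (fun z => G z k j) y := by
    intro i j k
    refine pd_congr (hs.mono fun z hz => ?_) i
    conv_lhs => rw [← hz]
    rfl
  have h2 : (conn G i y)ᵀ * G y = (G y * conn G i y)ᵀ := by rw [Matrix.transpose_mul, hsymm]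
  ext l j
  rw [h2, Matrix.add_apply, Matrix.transpose_apply, mul_conn_apply hdet, mul_conn_apply hdet]
  have h1 : (mpd i G y) l j = pd i (fun z => G z l j) y := rfl
  rw [h1, hpds i j l, hpds l i j, hpds j i l, hpds l j i, hpds j l i]
  ring

/-- The curvature matrices `F_{lk} = ∂ₗ Aₖ - ∂ₖ Aₗ + [Aₗ, Aₖ]`. -/
def curv (G : Coord n → Matrix (Fin n) (Fin n) ℝ) (l k : Fin n) (y : Coord n) :
    Matrix (Fin n) (Fin n) ℝ :=
  mpd l (conn G k) y - mpd k (conn G l) y + (conn G l y * conn G k y - conn G k y * conn G l y)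

/-- The Ricci tensor is a trace of the curvature matrices. The symmetry of `G` near `y` enters
through the order of the lower indices of the Christoffel symbols. -/
theorem coordRicci_eq_curv (hs : ∀ᶠ z in 𝓝 y, (G z)ᵀ = G z) (j k : Fin n) :
    coordRicci G j k y = ∑ i, curv G i k y i j := by
  have hev : ∀ a b c : Fin n, ∀ᶠ z in 𝓝 y, christoffel G a b c z = christoffel G a c b z := by
    intro a b c
    exact hs.eventually_nhds.mono fun z hz => conn_symm hz b c a
  have h0 : ∀ a b c : Fin n, christoffel G a b c y = christoffel G a c b y :=
    fun a b c => (hev a b c).self_of_nhds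
  simp only [coordRicci, curv, Matrix.add_apply, Matrix.sub_apply, Matrix.mul_apply, mpd,
    Matrix.of_apply, conn]
  rw [← Finset.sum_add_distrib]
  refine Finset.sum_congr rfl fun i _ => ?_
  rw [← Finset.sum_sub_distrib]
  congr 1
  · rw [pd_congr (hev i j k) i]
  · refine Finset.sum_congr rfl fun p _ => ?_
    rw [h0 p j k]

/-- A coordinate change `τ : Ω' → Ω` that pulls back the nondegenerate symmetric form `G` on `Ω` to
the form `G'` on `Ω'`. Neither positivity of `G` nor injectivity of `τ` is required. -/
structure IsPullback (τ : Coord n → Coord n) (G' G : Coord n → Matrix (Fin n) (Fin n) ℝ)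
    (Ω' Ω : Set (Coord n)) : Prop where
  isOpen_source : IsOpen Ω'
  isOpen_target : IsOpen Ω
  mapsTo : ∀ z ∈ Ω', τ z ∈ Ω
  smooth : ∀ z ∈ Ω', ContDiffAt ℝ ∞ τ z
  det_jac : ∀ z ∈ Ω', (jac τ z).det ≠ 0
  matSmooth : MatSmooth G Ω
  symm : ∀ z ∈ Ω, (G z)ᵀ = G z
  det_ne_zero : ∀ z ∈ Ω, (G z).det ≠ 0
  eq_pullback : ∀ z ∈ Ω', G' z = (jac τ z)ᵀ * G (τ z) * jac τ z

namespace IsPullback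

variable {τ : Coord n → Coord n} {G' : Coord n → Matrix (Fin n) (Fin n) ℝ}

theorem contDiffAt_coord (h : IsPullback τ G' G Ω' Ω) (hy : y ∈ Ω') (a : Fin n) :
    ContDiffAt ℝ ∞ (fun z => τ z a) y :=
  (EuclideanSpace.proj a : Coord n →L[ℝ] ℝ).contDiff.contDiffAt.comp y (h.smooth y hy)

theorem diff (h : IsPullback τ G' G Ω' Ω) (hy : y ∈ Ω') : DifferentiableAt ℝ τ y :=
  (h.smooth y hy).differentiableAt (by simp)

theorem matSmooth_jac (h : IsPullback τ G' G Ω' Ω) : MatSmooth (jac τ) Ω' :=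
  fun a i _ hy => contDiffAt_pd (h.contDiffAt_coord hy a) i

theorem mpd_jac_symm (h : IsPullback τ G' G Ω' Ω) (hy : y ∈ Ω') (i j a : Fin n) :
    mpd i (jac τ) y a j = mpd j (jac τ) y a i :=
  pd_pd_comm (h.contDiffAt_coord hy a) i j

theorem matSmooth_comp (h : IsPullback τ G' G Ω' Ω) {A : Coord n → Matrix (Fin n) (Fin n) ℝ}
    (hA : MatSmooth A Ω) : MatSmooth (fun z => A (τ z)) Ω' :=
  fun j k y hy => (hA j k _ (h.mapsTo y hy)).comp y (h.smooth y hy)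

theorem matSmooth_pullback (h : IsPullback τ G' G Ω' Ω) : MatSmooth G' Ω' := by
  have h1 : MatSmooth (fun z => (jac τ z)ᵀ * G (τ z) * jac τ z) Ω' :=
    (h.matSmooth_jac.transpose.mul (h.matSmooth_comp h.matSmooth)).mul h.matSmooth_jac
  intro j k y hy
  refine (h1 j k y hy).congr_of_eventuallyEq ?_
  filter_upwards [h.isOpen_source.mem_nhds hy] with z hz
  rw [h.eq_pullback z hz]

theorem det_pullback_ne_zero (h : IsPullback τ G' G Ω' Ω) (hy : y ∈ Ω') : (G' y).det ≠ 0 := by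
  rw [h.eq_pullback y hy, Matrix.det_mul, Matrix.det_mul, Matrix.det_transpose]
  exact mul_ne_zero (mul_ne_zero (h.det_jac y hy) (h.det_ne_zero _ (h.mapsTo y hy)))
    (h.det_jac y hy)

theorem symm_pullback (h : IsPullback τ G' G Ω' Ω) (hy : y ∈ Ω') : (G' y)ᵀ = G' y := by
  rw [h.eq_pullback y hy, Matrix.transpose_mul, Matrix.transpose_mul, Matrix.transpose_transpose,
    h.symm _ (h.mapsTo y hy), Matrix.mul_assoc]

/-- The pullback `∑ₘ J_{mi} A_m ∘ τ` of the connection matrices as one-forms. -/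
def connForm (τ : Coord n → Coord n) (G : Coord n → Matrix (Fin n) (Fin n) ℝ) (i : Fin n)
    (y : Coord n) : Matrix (Fin n) (Fin n) ℝ :=
  ∑ m, jac τ y m i • conn G m (τ y)

theorem matSmooth_connForm (h : IsPullback τ G' G Ω' Ω) (i : Fin n) :
    MatSmooth (connForm τ G i) Ω' :=
  MatSmooth.sum fun m _ => MatSmooth.smul (fun y hy => h.matSmooth_jac m i y hy)
    (h.matSmooth_comp (h.matSmooth.conn h.det_ne_zero m))

/-- The transformation law of the Christoffel symbols, as a gauge transformation. -/
theorem jac_mul_conn (h : IsPullback τ G' G Ω' Ω) (hy : y ∈ Ω') (i : Fin n) :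
    jac τ y * conn G' i y = connForm τ G i y * jac τ y + mpd i (jac τ) y := by
  set J := jac τ y with hJ
  have hu : IsUnit J.det := isUnit_iff_ne_zero.2 (h.det_jac y hy)
  have hτy := h.mapsTo y hy
  have hsG : ∀ᶠ z in 𝓝 (τ y), (G z)ᵀ = G z := by
    filter_upwards [h.isOpen_target.mem_nhds hτy] with z hz using h.symm z hz
  set X : Fin n → Matrix (Fin n) (Fin n) ℝ :=
    fun i => connForm τ G i y * J + mpd i (jac τ) y with hX
  have hXs : ∀ i j c, X i c j = X j c i := by
    intro i j c
    simp only [hX, Matrix.add_apply]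
    congr 1
    · simp only [connForm, Finset.sum_mul, Matrix.sum_apply, Matrix.smul_apply,
        Matrix.mul_apply, smul_eq_mul]
      rw [Finset.sum_comm]
      refine Finset.sum_congr rfl fun b _ => Finset.sum_congr rfl fun m _ => ?_
      rw [conn_symm hsG m b c]; ring
    · exact h.mpd_jac_symm hy i j c
  have hG'd : ∀ i, mpd i G' y = (X i)ᵀ * (G (τ y) * J) + Jᵀ * G (τ y) * X i := by
    intro i
    have e : G' =ᶠ[𝓝 y] fun z => (jac τ z)ᵀ * G (τ z) * jac τ z := by
      filter_upwards [h.isOpen_source.mem_nhds hy] with z hz using h.eq_pullback z hz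
    have hGτ : mpd i (fun z => G (τ z)) y
        = (connForm τ G i y)ᵀ * G (τ y) + G (τ y) * connForm τ G i y := by
      rw [mpd_comp h.matSmooth (h.diff hy) hτy]
      simp only [connForm, Matrix.transpose_sum, Finset.sum_mul, Finset.mul_sum,
        Matrix.transpose_smul, Matrix.smul_mul, Matrix.mul_smul]
      rw [← Finset.sum_add_distrib]
      refine Finset.sum_congr rfl fun m _ => ?_
      rw [conn_metric (h.det_ne_zero _ hτy) (h.symm _ hτy) hsG, smul_add]
    rw [mpd_congr e, mpd_mul (h.matSmooth_jac.transpose.mul (h.matSmooth_comp h.matSmooth))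
      h.matSmooth_jac hy, mpd_mul h.matSmooth_jac.transpose (h.matSmooth_comp h.matSmooth) hy,
      mpd_transpose, hGτ]
    simp only [hX, Matrix.transpose_add, Matrix.transpose_mul, ← hJ]
    noncomm_ring
  have key := eq_conn_of_symm_of_metric (h.det_pullback_ne_zero hy) (h.symm_pullback hy)
    (B := fun i => J⁻¹ * X i)
    (fun i j k => by
      simp only [Matrix.mul_apply]
      exact Finset.sum_congr rfl fun c _ => by rw [hXs])
    (fun i => by
      rw [hG'd, h.eq_pullback y hy, ← hJ, Matrix.transpose_mul]
      congr 1
      · rw [Matrix.mul_assoc, Matrix.mul_assoc Jᵀ, ← Matrix.mul_assoc (J⁻¹)ᵀ,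
          ← Matrix.transpose_mul, Matrix.mul_nonsing_inv _ hu, Matrix.transpose_one,
          Matrix.one_mul]
      · rw [Matrix.mul_assoc _ J, Matrix.mul_nonsing_inv_cancel_left _ _ hu]) i
  rw [← key, Matrix.mul_nonsing_inv_cancel_left _ _ hu]

/-- The curvature matrices transform as an endomorphism-valued two-form. -/
theorem jac_mul_curv (h : IsPullback τ G' G Ω' Ω) (hy : y ∈ Ω') (l k : Fin n) :
    jac τ y * curv G' l k y =
      (∑ m, ∑ r, (jac τ y m l * jac τ y r k) • curv G m r (τ y)) * jac τ y := by
  have hτy := h.mapsTo y hy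
  have hc := h.matSmooth_pullback.conn (fun z hz => h.det_pullback_ne_zero hz)
  have hcG := h.matSmooth.conn h.det_ne_zero
  have hJs := h.matSmooth_jac
  -- differentiating the transformation law of the connection
  have e1 : ∀ l k, mpd l (jac τ) y * conn G' k y + jac τ y * mpd l (conn G' k) y =
      mpd l (connForm τ G k) y * jac τ y + connForm τ G k y * mpd l (jac τ) y
        + mpd l (mpd k (jac τ)) y := by
    intro l k
    rw [← mpd_mul hJs (hc k) hy, ← mpd_mul (h.matSmooth_connForm k) hJs hy,
      ← mpd_add ((h.matSmooth_connForm k).mul hJs) (hJs.mpd k) hy]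
    refine mpd_congr ?_ l
    filter_upwards [h.isOpen_source.mem_nhds hy] with z hz using h.jac_mul_conn hz k
  have e2 : ∀ l k, jac τ y * (conn G' l y * conn G' k y) =
      connForm τ G l y * (connForm τ G k y * jac τ y + mpd k (jac τ) y)
        + mpd l (jac τ) y * conn G' k y := by
    intro l k
    rw [← Matrix.mul_assoc, h.jac_mul_conn hy l, ← h.jac_mul_conn hy k]
    noncomm_ring
  have e3 : ∀ l k, jac τ y * (mpd l (conn G' k) y + conn G' l y * conn G' k y) =
      mpd l (connForm τ G k) y * jac τ y + connForm τ G l y * connForm τ G k y * jac τ y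
        + (connForm τ G k y * mpd l (jac τ) y + connForm τ G l y * mpd k (jac τ) y
          + mpd l (mpd k (jac τ)) y) := by
    intro l k
    rw [Matrix.mul_add, e2, eq_sub_of_add_eq' (e1 l k)]
    noncomm_ring
  have e4 : jac τ y * curv G' l k y =
      (mpd l (connForm τ G k) y - mpd k (connForm τ G l) y + (connForm τ G l y * connForm τ G k y
        - connForm τ G k y * connForm τ G l y)) * jac τ y := by
    have : curv G' l k y = (mpd l (conn G' k) y + conn G' l y * conn G' k y)
        - (mpd k (conn G' l) y + conn G' k y * conn G' l y) := by
      rw [curv]; abel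
    rw [this, Matrix.mul_sub, e3, e3, mpd_mpd_comm hJs hy k l]
    noncomm_ring
  rw [e4]
  congr 1
  have e5 : ∀ l k, mpd l (connForm τ G k) y = ∑ m, (mpd l (jac τ) y m k • conn G m (τ y)
      + ∑ r, (jac τ y r l * jac τ y m k) • mpd r (conn G m) (τ y)) := by
    intro l k
    have hs : ∀ m : Fin n, ∀ z ∈ Ω', ContDiffAt ℝ ∞ (fun z => jac τ z m k) z :=
      fun m z hz => hJs m k z hz
    have : mpd l (connForm τ G k) y =
        ∑ m, mpd l (fun z => jac τ z m k • conn G m (τ z)) y :=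
      mpd_sum (fun m _ => MatSmooth.smul (hs m) (h.matSmooth_comp (hcG m))) hy l
    rw [this]
    refine Finset.sum_congr rfl fun m _ => ?_
    rw [mpd_smul (hs m) (h.matSmooth_comp (hcG m)) hy, mpd_comp (hcG m) (h.diff hy) hτy,
      Finset.smul_sum]
    congr 1
    exact Finset.sum_congr rfl fun r _ => by rw [smul_smul, mul_comm]
  have e6 : ∀ l k, connForm τ G l y * connForm τ G k y =
      ∑ m, ∑ r, (jac τ y m l * jac τ y r k) • (conn G m (τ y) * conn G r (τ y)) := by
    intro l k
    simp only [connForm, Finset.sum_mul, Finset.mul_sum, Matrix.smul_mul, Matrix.mul_smul,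
      smul_smul]
    rw [Finset.sum_comm]
    refine Finset.sum_congr rfl fun m _ => Finset.sum_congr rfl fun r _ => ?_
    rw [mul_comm]
  have e7 : ∀ l k, mpd l (connForm τ G k) y = ∑ m, mpd l (jac τ) y m k • conn G m (τ y)
      + ∑ m, ∑ r, (jac τ y m l * jac τ y r k) • mpd m (conn G r) (τ y) := by
    intro l k
    rw [e5, Finset.sum_add_distrib, Finset.sum_comm]
  have e8 : ∀ f : Fin n → Fin n → Matrix (Fin n) (Fin n) ℝ,
      ∑ m, ∑ r, (jac τ y m k * jac τ y r l) • f m r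
        = ∑ m, ∑ r, (jac τ y m l * jac τ y r k) • f r m := by
    intro f
    rw [Finset.sum_comm]
    exact Finset.sum_congr rfl fun m _ => Finset.sum_congr rfl fun r _ => by rw [mul_comm]
  rw [e6, e6, e7, e7, e8, e8]
  -- the terms with second derivatives of `τ` are symmetric in `k` and `l`, so that they cancel
  have e9 : ∑ m, mpd l (jac τ) y m k • conn G m (τ y) = ∑ m, mpd k (jac τ) y m l • conn G m (τ y) :=
    Finset.sum_congr rfl fun m _ => by rw [h.mpd_jac_symm hy l k m]
  rw [e9]
  simp only [curv, smul_add, smul_sub, Finset.sum_add_distrib, Finset.sum_sub_distrib]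
  abel

/-- The Ricci tensor transforms as a bilinear form. -/
theorem coordRicci_pullback (h : IsPullback τ G' G Ω' Ω) (hy : y ∈ Ω') :
    (Matrix.of fun j k => coordRicci G' j k y) =
      (jac τ y)ᵀ * (Matrix.of fun j k => coordRicci G j k (τ y)) * jac τ y := by
  have hτy := h.mapsTo y hy
  have hsG : ∀ᶠ z in 𝓝 (τ y), (G z)ᵀ = G z := by
    filter_upwards [h.isOpen_target.mem_nhds hτy] with z hz using h.symm z hz
  have hsG' : ∀ᶠ z in 𝓝 y, (G' z)ᵀ = G' z := by
    filter_upwards [h.isOpen_source.mem_nhds hy] with z hz using h.symm_pullback hz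
  set J := jac τ y with hJ
  have hu : IsUnit J.det := isUnit_iff_ne_zero.2 (h.det_jac y hy)
  have hF : ∀ l k, curv G' l k y = J⁻¹ * ((∑ m, ∑ r, (J m l * J r k) • curv G m r (τ y)) * J) := by
    intro l k
    rw [← h.jac_mul_curv hy, Matrix.nonsing_inv_mul_cancel_left _ _ hu]
  have hJJ : ∀ m a, ∑ i, J m i * J⁻¹ i a = (1 : Matrix (Fin n) (Fin n) ℝ) m a := by
    intro m a
    rw [← Matrix.mul_nonsing_inv _ hu, Matrix.mul_apply]
  ext j k
  simp only [Matrix.of_apply]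
  rw [coordRicci_eq_curv hsG']
  have hR : ∀ j k, coordRicci G j k (τ y) = ∑ i, curv G i k (τ y) i j :=
    fun j k => coordRicci_eq_curv hsG j k
  set Y : Fin n → Matrix (Fin n) (Fin n) ℝ := fun m => ∑ r, J r k • curv G m r (τ y) with hY
  have h1 : ∀ i, curv G' i k y i j = ∑ m, ∑ a, (J m i * J⁻¹ i a) * (Y m * J) a j := by
    intro i
    have hX : ∑ m, ∑ r, (J m i * J r k) • curv G m r (τ y) = ∑ m, J m i • Y m := by
      simp only [hY, Finset.smul_sum, smul_smul]
    rw [hF, hX, Matrix.mul_apply, Finset.sum_comm]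
    refine Finset.sum_congr rfl fun a _ => ?_
    simp only [Finset.sum_mul, Matrix.sum_apply, Matrix.smul_mul, Matrix.smul_apply,
      smul_eq_mul, Finset.mul_sum]
    exact Finset.sum_congr rfl fun m _ => by ring
  have h2 : ∑ i, curv G' i k y i j = ∑ m, (Y m * J) m j := by
    simp only [h1]
    rw [Finset.sum_comm]
    refine Finset.sum_congr rfl fun m _ => ?_
    rw [Finset.sum_comm]
    simp only [← Finset.sum_mul, hJJ, Matrix.one_apply, ite_mul, one_mul, zero_mul,
      Finset.sum_ite_eq, Finset.mem_univ, if_true]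
  rw [h2]
  simp only [hY, Matrix.mul_apply, Matrix.transpose_apply, Matrix.of_apply, hR, Matrix.sum_apply,
    Matrix.smul_apply, smul_eq_mul, Finset.sum_mul, Finset.mul_sum]
  calc ∑ m, ∑ b, ∑ r, J r k * curv G m r (τ y) m b * J b j
      = ∑ m, ∑ r, ∑ b, J r k * curv G m r (τ y) m b * J b j :=
        Finset.sum_congr rfl fun m _ => Finset.sum_comm
    _ = ∑ r, ∑ m, ∑ b, J r k * curv G m r (τ y) m b * J b j := Finset.sum_comm
    _ = ∑ r, ∑ b, ∑ m, J r k * curv G m r (τ y) m b * J b j :=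
        Finset.sum_congr rfl fun m _ => Finset.sum_comm
    _ = ∑ r, ∑ b, ∑ m, J b j * curv G m r (τ y) m b * J r k :=
        Finset.sum_congr rfl fun r _ => Finset.sum_congr rfl fun b _ =>
          Finset.sum_congr rfl fun m _ => by ring

/-- The scalar curvature does not depend on the choice of coordinates. -/
theorem coordScal_pullback (h : IsPullback τ G' G Ω' Ω) (hy : y ∈ Ω') :
    coordScal G' y = coordScal G (τ y) := by
  have hform : ∀ (H : Coord n → Matrix (Fin n) (Fin n) ℝ) (z : Coord n),
      coordScal H z = (((H z)⁻¹)ᵀ * (Matrix.of fun j k => coordRicci H j k z)).trace := by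
    intro H z
    simp only [coordScal, Matrix.trace, Matrix.diag, Matrix.mul_apply, Matrix.transpose_apply,
      Matrix.of_apply]
    rw [Finset.sum_comm]
  have hu : IsUnit (jac τ y).det := isUnit_iff_ne_zero.2 (h.det_jac y hy)
  rw [hform, hform, h.coordRicci_pullback hy, h.eq_pullback y hy, Matrix.mul_inv_rev,
    Matrix.mul_inv_rev, Matrix.transpose_mul, Matrix.transpose_mul]
  set J := jac τ y
  set R := (Matrix.of fun j k => coordRicci G j k (τ y))
  have h1 : ((Jᵀ)⁻¹)ᵀ = J⁻¹ := by rw [← Matrix.transpose_nonsing_inv, Matrix.transpose_transpose]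
  have h2 : (J⁻¹)ᵀ * (Jᵀ * (R * J)) = R * J := by
    rw [← Matrix.mul_assoc, ← Matrix.transpose_mul, Matrix.mul_nonsing_inv _ hu,
      Matrix.transpose_one, Matrix.one_mul]
  rw [h1, Matrix.mul_assoc, Matrix.mul_assoc Jᵀ, h2, Matrix.mul_assoc, Matrix.trace_mul_comm,
    Matrix.mul_assoc, Matrix.mul_assoc, Matrix.mul_nonsing_inv _ hu, Matrix.mul_one]

end IsPullback

end Curvature

section JetScal

open Matrix

variable {n : ℕ} {Ω : Set (Coord n)} {G : Coord n → Matrix (Fin n) (Fin n) ℝ} {y : Coord n}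

/-! ### The scalar curvature as a function of the 2-jet -/

/-- The inverse matrix `(g^{ij})` as a function of the `2`-jet. -/
def jetInv (z : JetCoord n) : Matrix (Fin n) (Fin n) ℝ := (Matrix.of z.2.1)⁻¹

/-- The Christoffel symbols as functions of the `2`-jet. -/
def jetChristoffel (k i j : Fin n) (z : JetCoord n) : ℝ :=
  (1 / 2) * ∑ l, jetInv z k l * (z.2.2.1 i j l + z.2.2.1 j i l - z.2.2.1 l i j)

/-- The partial derivatives `∂ₘ g^{kl} = -∑ g^{ka} ∂ₘ g_{ab} g^{bl}` as functions of the `2`-jet. -/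
def jetDInv (m k l : Fin n) (z : JetCoord n) : ℝ :=
  -∑ b, (∑ a, jetInv z k a * z.2.2.1 m a b) * jetInv z b l

/-- The partial derivatives `∂ₘ Γᵏ_{ij}` as functions of the `2`-jet. -/
def jetDChristoffel (m k i j : Fin n) (z : JetCoord n) : ℝ :=
  (1 / 2) * ∑ l, (jetDInv m k l z * (z.2.2.1 i j l + z.2.2.1 j i l - z.2.2.1 l i j) +
    jetInv z k l * (z.2.2.2 m i j l + z.2.2.2 m j i l - z.2.2.2 m l i j))

/-- The scalar curvature as a function of the `2`-jet. -/
def jetScal (z : JetCoord n) : ℝ :=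
  ∑ j, ∑ k, jetInv z j k *
    (∑ i, (jetDChristoffel i i j k z - jetDChristoffel k i i j z) +
      ∑ i, ∑ p, (jetChristoffel i i p z * jetChristoffel p j k z -
        jetChristoffel i k p z * jetChristoffel p i j z))

/-- The coordinates of the `2`-jet of a matrix-valued function. -/
def matJet (G : Coord n → Matrix (Fin n) (Fin n) ℝ) (y : Coord n) : JetCoord n :=
  (y, fun i j => G y i j, fun k i j => pd k (fun z => G z i j) y,
    fun l k i j => pd l (pd k (fun z => G z i j)) y)

theorem continuousAt_inv_entry {X : Type*} [TopologicalSpace X]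
    {A : X → Matrix (Fin n) (Fin n) ℝ} {x : X} (hA : ContinuousAt A x) (hd : (A x).det ≠ 0) :
    ContinuousAt (fun x => (A x)⁻¹) x := by
  have h : (fun x => (A x)⁻¹) = fun x => ((A x).det)⁻¹ • (A x).adjugate := by
    funext z
    rw [Matrix.inv_def, Ring.inverse_eq_inv']
  rw [h]
  have h1 : ContinuousAt (fun x => (A x).det) x :=
    (continuous_id.matrix_det.continuousAt (x := A x)).comp hA
  have h2 : ContinuousAt (fun x => (A x).adjugate) x :=
    (continuous_id.matrix_adjugate.continuousAt (x := A x)).comp hA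
  exact (h1.inv₀ hd).smul h2

theorem continuousAt_jetInv {z : JetCoord n} (hz : (Matrix.of z.2.1).det ≠ 0) :
    ContinuousAt (jetInv (n := n)) z := by
  refine continuousAt_inv_entry ?_ hz
  have : Continuous fun z : JetCoord n => (Matrix.of z.2.1 : Matrix (Fin n) (Fin n) ℝ) :=
    continuous_snd.fst
  exact this.continuousAt

theorem continuousAt_jetScal {z : JetCoord n} (hz : (Matrix.of z.2.1).det ≠ 0) :
    ContinuousAt (jetScal (n := n)) z := by
  have hI : ∀ i j, ContinuousAt (fun z : JetCoord n => jetInv z i j) z := fun i j =>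
    ((continuous_id.matrix_elem i j).continuousAt (x := jetInv z)).comp (continuousAt_jetInv hz)
  have hC : ∀ k i j, ContinuousAt (jetChristoffel (n := n) k i j) z := by
    intro k i j
    unfold jetChristoffel
    fun_prop
  have hDI : ∀ m k l, ContinuousAt (jetDInv (n := n) m k l) z := by
    intro m k l
    unfold jetDInv
    fun_prop
  have hDC : ∀ m k i j, ContinuousAt (jetDChristoffel (n := n) m k i j) z := by
    intro m k i j
    unfold jetDChristoffel
    fun_prop
  unfold jetScal
  fun_prop

/-- The derivative `∂(G⁻¹) = -G⁻¹ (∂G) G⁻¹` of the inverse metric. -/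
theorem mpd_inv (hΩ : IsOpen Ω) (hG : MatSmooth G Ω) (hdet : ∀ y ∈ Ω, (G y).det ≠ 0) (hy : y ∈ Ω)
    (m : Fin n) : mpd m (fun z => (G z)⁻¹) y = -((G y)⁻¹ * mpd m G y * (G y)⁻¹) := by
  have h1 : mpd m (fun z => (G z)⁻¹ * G z) y = 0 := by
    have e : (fun z => (G z)⁻¹ * G z) =ᶠ[𝓝 y] fun _ => 1 := by
      filter_upwards [hΩ.mem_nhds hy] with z hz
      exact Matrix.nonsing_inv_mul _ (isUnit_iff_ne_zero.2 (hdet z hz))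
    rw [mpd_congr e]
    ext a b
    simp [mpd, pd]
  rw [mpd_mul (hG.inv hdet) hG hy] at h1
  have hu := isUnit_iff_ne_zero.2 (hdet y hy)
  calc mpd m (fun z => (G z)⁻¹) y
      = mpd m (fun z => (G z)⁻¹) y * G y * (G y)⁻¹ := by
        rw [Matrix.mul_assoc, Matrix.mul_nonsing_inv _ hu, Matrix.mul_one]
    _ = _ := by rw [eq_neg_of_add_eq_zero_left h1, Matrix.neg_mul]

theorem christoffel_eq_jet (k i j : Fin n) :
    christoffel G k i j y = jetChristoffel k i j (matJet G y) := rfl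

theorem pd_christoffel_eq_jet (hΩ : IsOpen Ω) (hG : MatSmooth G Ω)
    (hdet : ∀ y ∈ Ω, (G y).det ≠ 0) (hy : y ∈ Ω) (m k i j : Fin n) :
    pd m (christoffel G k i j) y = jetDChristoffel m k i j (matJet G y) := by
  have hD : ∀ a b c, ContDiffAt ℝ ∞ (pd a (fun z => G z b c)) y :=
    fun a b c => contDiffAt_pd (hG b c y hy) a
  have hd : ∀ a b c, DifferentiableAt ℝ (pd a (fun z => G z b c)) y :=
    fun a b c => differentiableAt_of_contDiffAt_infty (hD a b c)
  have hI := hG.inv hdet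
  have hs : ∀ l, DifferentiableAt ℝ (fun y => pd i (fun z => G z j l) y
      + pd j (fun z => G z i l) y - pd l (fun z => G z i j) y) y :=
    fun l => ((hd i j l).fun_add (hd j i l)).fun_sub (hd l i j)
  unfold christoffel jetDChristoffel
  rw [pd_const_mul (DifferentiableAt.fun_sum fun l _ => (hI.diff hy k l).fun_mul (hs l)),
    pd_sum (f := fun l y => (G y)⁻¹ k l * (pd i (fun z => G z j l) y + pd j (fun z => G z i l) y
      - pd l (fun z => G z i j) y)) (fun l _ => (hI.diff hy k l).fun_mul (hs l))]
  congr 1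
  refine Finset.sum_congr rfl fun l _ => ?_
  rw [pd_mul (hI.diff hy k l) (hs l), pd_sub ((hd i j l).fun_add (hd j i l)) (hd l i j),
    pd_add (hd i j l) (hd j i l)]
  have h1 : pd m (fun z => (G z)⁻¹ k l) y = jetDInv m k l (matJet G y) := by
    have : pd m (fun z => (G z)⁻¹ k l) y = mpd m (fun z => (G z)⁻¹) y k l := rfl
    rw [this, mpd_inv hΩ hG hdet hy, Matrix.neg_apply, Matrix.mul_apply]
    simp only [Matrix.mul_apply]
    rfl
  rw [h1]
  rfl

/-- The scalar curvature of a coordinate metric at a point is a function of the `2`-jet of the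
metric at this point. -/
theorem coordScal_eq_jet (hΩ : IsOpen Ω) (hG : MatSmooth G Ω)
    (hdet : ∀ y ∈ Ω, (G y).det ≠ 0) (hy : y ∈ Ω) :
    coordScal G y = jetScal (matJet G y) := by
  simp only [coordScal, coordRicci, pd_christoffel_eq_jet hΩ hG hdet hy, christoffel_eq_jet]
  rfl

theorem continuousAt_matJet (hG : MatSmooth G Ω) (hy : y ∈ Ω) : ContinuousAt (matJet G) y := by
  unfold matJet
  refine continuousAt_id.prodMk (ContinuousAt.prodMk ?_ (ContinuousAt.prodMk ?_ ?_))
  · exact continuousAt_pi.2 fun i => continuousAt_pi.2 fun j => (hG i j y hy).continuousAt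
  · exact continuousAt_pi.2 fun k => continuousAt_pi.2 fun i => continuousAt_pi.2 fun j =>
      (contDiffAt_pd (hG i j y hy) k).continuousAt
  · exact continuousAt_pi.2 fun l => continuousAt_pi.2 fun k => continuousAt_pi.2 fun i =>
      continuousAt_pi.2 fun j => (contDiffAt_pd (contDiffAt_pd (hG i j y hy) k) l).continuousAt

end JetScal

section Coordinates

open Matrix

variable {n : ℕ} {M : Type*} [TopologicalSpace M] [ChartedSpace (Coord n) M]

/-! ### Coordinate expressions of metrics in charts -/

/-- The coordinate vector `∂ᵢ ∈ T_xM` of the chart `e`, as a function of `x` instead of `e x`. -/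
def chartVec (e : OpenPartialHomeomorph M (Coord n)) (x : M) (i : Fin n) :
    TangentSpace (𝓡 n) x :=
  (mfderiv (𝓡 n) (𝓡 n) e.symm (e x) (stdVec n i) : Coord n)

theorem coordForm_eq_gram (g : FormField n M) {e : OpenPartialHomeomorph M (Coord n)} {x : M}
    (hx : x ∈ e.source) : coordForm g e (e x) = gram g x (chartVec e x) := by
  have key : ∀ (x' : M) (w : Fin n → Coord n), x' = x →
      gram g x' w = gram g x w := by
    rintro x' w rfl; rfl
  exact key (e.symm (e x)) _ (e.left_inv hx)

theorem gram_comb (g : FormField n M) (x : M) {v w : Fin n → TangentSpace (𝓡 n) x}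
    {J : Matrix (Fin n) (Fin n) ℝ} (h : ∀ i, v i = ∑ a, J a i • w a) :
    gram g x v = Jᵀ * gram g x w * J := by
  ext i j
  simp only [gram, Matrix.of_apply, h, map_sum, map_smul, _root_.sum_apply,
    _root_.smul_apply, smul_eq_mul, Matrix.mul_apply, Matrix.transpose_apply,
    Finset.sum_mul, Finset.mul_sum]
  exact Finset.sum_congr rfl fun b _ => Finset.sum_congr rfl fun a _ => by ring

theorem gram_quadratic (g : FormField n M) (x : M) (w : Fin n → TangentSpace (𝓡 n) x)
    (ξ : Fin n → ℝ) :
    ξ ⬝ᵥ (gram g x w *ᵥ ξ) = g x (∑ i, ξ i • w i) (∑ i, ξ i • w i) := by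
  simp only [gram, dotProduct, Matrix.mulVec, Matrix.of_apply, map_sum, map_smul,
    _root_.sum_apply, _root_.smul_apply, smul_eq_mul, Finset.mul_sum]
  rw [Finset.sum_comm]
  exact Finset.sum_congr rfl fun b _ => Finset.sum_congr rfl fun a _ => by ring

theorem gram_transpose {g : FormField n M} {x : M} (hsymm : ∀ v w, g x v w = g x w v)
    (v : Fin n → TangentSpace (𝓡 n) x) : (gram g x v)ᵀ = gram g x v := by
  ext i j
  exact hsymm _ _

theorem clm_apply_eq_sum (L : Coord n →L[ℝ] Coord n) (v : Coord n) :
    L v = ∑ a, v a • L (stdVec n a) := by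
  conv_lhs => rw [coord_eq_sum v]
  simp only [map_sum, map_smul]

/-- The components of a tangent vector with respect to the chart `e`. -/
def chartComp (e : OpenPartialHomeomorph M (Coord n)) (x : M) (v : TangentSpace (𝓡 n) x) :
    Coord n :=
  mfderiv (𝓡 n) (𝓡 n) e x v

/-- The Gram matrix in the standard frame of `T_xM`. -/
def stdGram (g : FormField n M) (x : M) : Matrix (Fin n) (Fin n) ℝ :=
  gram g x (stdVec n)

theorem stdGram_pos {g : FormField n M} {x : M} (hpos : ∀ v, v ≠ 0 → 0 < g x v v)
    {ξ : Fin n → ℝ} (hξ : ξ ≠ 0) : 0 < ξ ⬝ᵥ (stdGram g x *ᵥ ξ) := by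
  have h1 := gram_quadratic g x (stdVec n) ξ
  rw [stdGram, h1]
  refine hpos _ fun h0 => hξ ?_
  have h2 : WithLp.toLp 2 ξ = (0 : Coord n) := (coord_eq_sum (WithLp.toLp 2 ξ)).trans h0
  exact (WithLp.toLp_injective 2) h2

theorem stdGram_posDef {g : FormField n M} {x : M} (hsymm : ∀ v w, g x v w = g x w v)
    (hpos : ∀ v, v ≠ 0 → 0 < g x v v) : (stdGram g x).PosDef := by
  refine Matrix.PosDef.of_dotProduct_mulVec_pos ?_ fun ξ hξ => ?_
  · exact gram_transpose hsymm _
  · simpa using stdGram_pos hpos hξ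

theorem det_stdGram_pos {g : FormField n M} {x : M} (hsymm : ∀ v w, g x v w = g x w v)
    (hpos : ∀ v, v ≠ 0 → 0 < g x v v) : 0 < (stdGram g x).det :=
  (stdGram_posDef hsymm hpos).det_pos

theorem coordForm_transpose {g : FormField n M} {e : OpenPartialHomeomorph M (Coord n)}
    {y : Coord n}
    (hsymm : ∀ v w, g (e.symm y) v w = g (e.symm y) w v) :
    (coordForm g e y)ᵀ = coordForm g e y :=
  gram_transpose hsymm _

variable [IsManifold (𝓡 n) ∞ M]

theorem mem_maximalAtlas {e : OpenPartialHomeomorph M (Coord n)} (he : e ∈ atlas (Coord n) M) :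
    e ∈ IsManifold.maximalAtlas (𝓡 n) ∞ M :=
  IsManifold.subset_maximalAtlas he

variable {e e' : OpenPartialHomeomorph M (Coord n)}

theorem mdifferentiable_chart (he : e ∈ atlas (Coord n) M) :
    e.MDifferentiable (𝓡 n) (𝓡 n) := by
  have : IsManifold (𝓡 n) 1 M := IsManifold.of_le (n := ∞) (by exact_mod_cast le_top)
  exact mdifferentiable_of_mem_atlas he

theorem contMDiffAt_chart (he : e ∈ atlas (Coord n) M) {x : M} (hx : x ∈ e.source) :
    ContMDiffAt (𝓡 n) (𝓡 n) ∞ e x :=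
  (contMDiffOn_of_mem_maximalAtlas (mem_maximalAtlas he)).contMDiffAt (e.open_source.mem_nhds hx)

theorem contMDiffAt_chart_symm (he : e ∈ atlas (Coord n) M) {y : Coord n} (hy : y ∈ e.target) :
    ContMDiffAt (𝓡 n) (𝓡 n) ∞ e.symm y :=
  (contMDiffOn_symm_of_mem_maximalAtlas (mem_maximalAtlas he)).contMDiffAt
    (e.open_target.mem_nhds hy)

/-- The expansion of a tangent vector in the coordinate basis. -/
theorem eq_sum_chartVec (he : e ∈ atlas (Coord n) M) {x : M} (hx : x ∈ e.source)
    (v : TangentSpace (𝓡 n) x) :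
    v = ∑ a, chartComp e x v a • chartVec e x a := by
  have h := (mdifferentiable_chart he).symm_comp_deriv hx
  have h1 : v = (mfderiv (𝓡 n) (𝓡 n) e.symm (e x)) (mfderiv (𝓡 n) (𝓡 n) e x v) := by
    have := congrArg (fun L => L v) h
    exact this.symm
  exact h1.trans (clm_apply_eq_sum (n := n) (mfderiv (𝓡 n) (𝓡 n) e.symm (e x)) (chartComp e x v))

theorem transition_contDiffAt (he : e ∈ atlas (Coord n) M) (he' : e' ∈ atlas (Coord n) M)
    {y : Coord n} (hy : y ∈ e'.target) (hy' : e'.symm y ∈ e.source) :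
    ContDiffAt ℝ ∞ (fun z => e (e'.symm z)) y := by
  rw [← contMDiffAt_iff_contDiffAt]
  exact (contMDiffAt_chart he hy').comp y (contMDiffAt_chart_symm he' hy)

/-- The transition rule for coordinate vectors. -/
theorem chartVec_transition (he : e ∈ atlas (Coord n) M) (he' : e' ∈ atlas (Coord n) M) {x : M}
    (hx : x ∈ e.source) (hx' : x ∈ e'.source) (i : Fin n) :
    chartVec e' x i = ∑ a, jac (fun z => e (e'.symm z)) (e' x) a i • chartVec e x a := by
  set τ : Coord n → Coord n := fun z => e (e'.symm z) with hτ
  have hy : e' x ∈ e'.target := e'.map_source hx'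
  have hy' : e'.symm (e' x) ∈ e.source := by rwa [e'.left_inv hx']
  have hτx : τ (e' x) = e x := by simp only [hτ, e'.left_inv hx']
  have hτd : DifferentiableAt ℝ τ (e' x) :=
    (transition_contDiffAt he he' hy hy').differentiableAt (by simp)
  have hev : e'.symm =ᶠ[𝓝 (e' x)] e.symm ∘ τ := by
    have h1 : ∀ᶠ z in 𝓝 (e' x), e'.symm z ∈ e.source :=
      (e'.continuousAt_symm hy).eventually (e.open_source.mem_nhds hy')
    filter_upwards [h1] with z hz
    simp only [hτ, Function.comp_apply, e.left_inv hz]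
  have hd : MDifferentiableAt (𝓡 n) (𝓡 n) e.symm (τ (e' x)) := by
    rw [hτx]; exact (mdifferentiable_chart he).mdifferentiableAt_symm (e.map_source hx)
  have h2 : ∀ v : Coord n, (mfderiv (𝓡 n) (𝓡 n) e'.symm (e' x) v : Coord n) =
      (mfderiv (𝓡 n) (𝓡 n) e.symm (e x) (fderiv ℝ τ (e' x) v) : Coord n) := by
    intro v
    have h3 := hev.mfderiv_eq (I := 𝓡 n) (I' := 𝓡 n)
    have h4 := mfderiv_comp (I := 𝓡 n) (I' := 𝓡 n) (I'' := 𝓡 n) (e' x) hd hτd.mdifferentiableAt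
    have h5 : (mfderiv (𝓡 n) (𝓡 n) e'.symm (e' x) : Coord n →L[ℝ] Coord n) =
      (mfderiv (𝓡 n) (𝓡 n) (e.symm ∘ τ) (e' x) : Coord n →L[ℝ] Coord n) := h3
    have h6 : (mfderiv (𝓡 n) (𝓡 n) (e.symm ∘ τ) (e' x) : Coord n →L[ℝ] Coord n) =
      (mfderiv (𝓡 n) (𝓡 n) e.symm (τ (e' x)) : Coord n →L[ℝ] Coord n).comp
        (fderiv ℝ τ (e' x)) :=
      h4.trans (congrArg (fun L : Coord n →L[ℝ] Coord n =>
        (mfderiv (𝓡 n) (𝓡 n) e.symm (τ (e' x)) : Coord n →L[ℝ] Coord n).comp L)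
        (mfderiv_eq_fderiv (f := τ) (x := e' x)))
    have h7 := congrArg (fun L : Coord n →L[ℝ] Coord n => L v) (h5.trans h6)
    rw [hτx] at h7
    exact h7
  have h8 : chartVec e' x i =
      (mfderiv (𝓡 n) (𝓡 n) e.symm (e x) (fderiv ℝ τ (e' x) (stdVec n i)) : Coord n) :=
    h2 (stdVec n i)
  have h9 := clm_apply_eq_sum (n := n) (mfderiv (𝓡 n) (𝓡 n) e.symm (e x))
    (fderiv ℝ τ (e' x) (stdVec n i))
  refine h8.trans (h9.trans ?_)
  refine Finset.sum_congr rfl fun a _ => ?_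
  rw [fderiv_apply_coord hτd]
  rfl

theorem contDiffAt_coordForm {g : FormField n M} (he : e ∈ atlas (Coord n) M) {y : Coord n}
    (hy : y ∈ e.target)
    (hg : ContMDiffAt (𝓡 n) ((𝓡 n).prod 𝓘(ℝ, Form n)) ∞
      (fun b => Bundle.TotalSpace.mk' (Form n)
        (E := fun x : M => TangentSpace (𝓡 n) x →L[ℝ] TangentSpace (𝓡 n) x →L[ℝ] ℝ) b (g b))
      (e.symm y)) (i j : Fin n) :
    ContDiffAt ℝ ∞ (fun z => coordForm g e z i j) y := by
  have hs := contMDiffAt_chart_symm he hy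
  have hvec : ∀ i, ContMDiffAt (𝓡 n) ((𝓡 n).prod (𝓡 n)) ∞
      (fun z => Bundle.TotalSpace.mk' (Coord n) (E := fun x : M => TangentSpace (𝓡 n) x)
        (e.symm z) (coordVec e z i)) y := by
    intro i
    have h1 : ContMDiffAt (𝓡 n) ((𝓡 n).prod (𝓡 n)) ∞
      (fun z => Bundle.TotalSpace.mk' (Coord n) (E := fun x : Coord n => TangentSpace (𝓡 n) x)
        z (stdVec n i)) y :=
      contMDiffAt_vectorSpace_iff_contDiffAt.2 contDiffAt_const
    exact ContMDiffAt.clm_apply_of_inCoordinates (hs.mfderiv_const (m := ∞) (by simp)) h1 hs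
  have h3 : ContMDiffAt (𝓡 n) ((𝓡 n).prod 𝓘(ℝ)) ∞
      (fun z => Bundle.TotalSpace.mk' ℝ (E := Bundle.Trivial M ℝ) (e.symm z)
        (g (e.symm z) (coordVec e z i) (coordVec e z j))) y := by
    apply ContMDiffAt.clm_bundle_apply₂ (F₁ := Coord n) (F₂ := Coord n)
    · exact hg.comp y hs
    · exact hvec i
    · exact hvec j
  rw [Bundle.contMDiffAt_totalSpace] at h3
  rw [← contMDiffAt_iff_contDiffAt]
  exact h3.2

/-! ### Change of frame -/

/-- The matrix of components of the standard frame with respect to the chart `e`. -/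
def stdToChart (e : OpenPartialHomeomorph M (Coord n)) (x : M) : Matrix (Fin n) (Fin n) ℝ :=
  Matrix.of fun a i => chartComp e x (stdVec n i) a

theorem stdGram_eq (g : FormField n M) (he : e ∈ atlas (Coord n) M) {x : M} (hx : x ∈ e.source) :
    stdGram g x = (stdToChart e x)ᵀ * coordForm g e (e x) * stdToChart e x := by
  rw [coordForm_eq_gram g hx]
  exact gram_comb g x fun i => eq_sum_chartVec he hx _

theorem det_stdGram_eq (g : FormField n M) (he : e ∈ atlas (Coord n) M) {x : M}
    (hx : x ∈ e.source) :
    (stdGram g x).det = (stdToChart e x).det ^ 2 * (coordForm g e (e x)).det := by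
  rw [stdGram_eq g he hx, Matrix.det_mul, Matrix.det_mul, Matrix.det_transpose]; ring

theorem det_coordForm_pos {g : FormField n M} (he : e ∈ atlas (Coord n) M) {x : M}
    (hx : x ∈ e.source) (hsymm : ∀ v w, g x v w = g x w v)
    (hpos : ∀ v, v ≠ 0 → 0 < g x v v) : 0 < (coordForm g e (e x)).det := by
  have h := det_stdGram_pos hsymm hpos
  rw [det_stdGram_eq g he hx] at h
  exact pos_of_mul_pos_right h (sq_nonneg _)

theorem det_stdToChart_ne_zero {g : FormField n M} (he : e ∈ atlas (Coord n) M) {x : M}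
    (hx : x ∈ e.source) (hsymm : ∀ v w, g x v w = g x w v)
    (hpos : ∀ v, v ≠ 0 → 0 < g x v v) : (stdToChart e x).det ≠ 0 := by
  have h := det_stdGram_pos hsymm hpos
  rw [det_stdGram_eq g he hx] at h
  intro h0
  rw [h0] at h
  simp at h

theorem coordForm_transition (g : FormField n M) (he : e ∈ atlas (Coord n) M)
    (he' : e' ∈ atlas (Coord n) M) {x : M} (hx : x ∈ e.source) (hx' : x ∈ e'.source) :
    coordForm g e' (e' x) = (jac (fun z => e (e'.symm z)) (e' x))ᵀ * coordForm g e (e x) *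
      jac (fun z => e (e'.symm z)) (e' x) := by
  rw [coordForm_eq_gram g hx, coordForm_eq_gram g hx']
  exact gram_comb g x fun i => chartVec_transition he he' hx hx' i

end Coordinates

section Invariants

open Matrix

variable {n : ℕ} {M : Type*} [TopologicalSpace M] [ChartedSpace (Coord n) M]

/-! ### Scalar curvature and gradient in arbitrary charts -/

theorem coordJet_eq_matJet (h : FormField n M) (x : M)
    (e : OpenPartialHomeomorph M (Coord n)) : coordJet h x e = matJet (coordForm h e) (e x) := rfl

theorem cotangentNormSq_eq (g : FormField n M) (x : M) (α : TangentSpace (𝓡 n) x →L[ℝ] ℝ) :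
    cotangentNormSq g x α =
      (fun i => α (stdVec n i)) ⬝ᵥ ((stdGram g x)⁻¹ *ᵥ fun i => α (stdVec n i)) := by
  simp only [cotangentNormSq, dotProduct, Matrix.mulVec, stdGram, Finset.mul_sum]
  exact Finset.sum_congr rfl fun b _ => Finset.sum_congr rfl fun a _ => by ring

/-- The differential `dv(x)` of a function, as a cotangent vector. -/
def differential (v : M → ℝ) (x : M) : TangentSpace (𝓡 n) x →L[ℝ] ℝ :=
  mfderiv (𝓡 n) 𝓘(ℝ, ℝ) v x

variable [IsManifold (𝓡 n) ∞ M] {e e' : OpenPartialHomeomorph M (Coord n)} {h : FormField n M}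

/-- The points at which a field of bilinear forms is smooth, symmetric and positive definite. -/
def IsGood (h : FormField n M) (y : M) : Prop :=
  ContMDiffAt (𝓡 n) ((𝓡 n).prod 𝓘(ℝ, Form n)) ∞
      (fun b => Bundle.TotalSpace.mk' (Form n)
        (E := fun x : M => TangentSpace (𝓡 n) x →L[ℝ] TangentSpace (𝓡 n) x →L[ℝ] ℝ) b (h b)) y ∧
    (∀ v w, h y v w = h y w v) ∧ (∀ v, v ≠ 0 → 0 < h y v v)

theorem IsMetricNear.exists_isOpen {x : M} (hx : IsMetricNear h x) :
    ∃ S : Set M, IsOpen S ∧ x ∈ S ∧ ∀ y ∈ S, IsGood h y := by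
  obtain ⟨S, hS, hSo, hxS⟩ := eventually_nhds_iff.1 hx
  exact ⟨S, hSo, hxS, hS⟩

theorem IsMetricNear.isGood {x : M} (hx : IsMetricNear h x) : IsGood h x := hx.self_of_nhds

theorem matSmooth_coordForm (he : e ∈ atlas (Coord n) M) {S : Set M} (hS : ∀ y ∈ S, IsGood h y) :
    MatSmooth (coordForm h e) (e.target ∩ e.symm ⁻¹' S) :=
  fun i j _ hy => contDiffAt_coordForm he hy.1 (hS _ hy.2).1 i j

theorem det_coordForm_ne_zero (he : e ∈ atlas (Coord n) M) {S : Set M}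
    (hS : ∀ y ∈ S, IsGood h y) {y : Coord n} (hy : y ∈ e.target ∩ e.symm ⁻¹' S) :
    (coordForm h e y).det ≠ 0 := by
  have := det_coordForm_pos he (e.map_target hy.1) (hS _ hy.2).2.1 (hS _ hy.2).2.2
  rw [e.right_inv hy.1] at this
  exact this.ne'

/-- The coordinate expressions of a metric in two charts are related by pullback along the
transition map. -/
theorem isPullback_transition (he : e ∈ atlas (Coord n) M) (he' : e' ∈ atlas (Coord n) M)
    {S : Set M} (hSo : IsOpen S) (hS : ∀ y ∈ S, IsGood h y) :
    IsPullback (fun z => e (e'.symm z)) (coordForm h e') (coordForm h e)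
      (e'.target ∩ e'.symm ⁻¹' (S ∩ e.source)) (e.target ∩ e.symm ⁻¹' S) := by
  have heq : ∀ z ∈ e'.target ∩ e'.symm ⁻¹' (S ∩ e.source), coordForm h e' z =
      (jac (fun z => e (e'.symm z)) z)ᵀ * coordForm h e (e (e'.symm z)) *
        jac (fun z => e (e'.symm z)) z := by
    intro z hz
    have := coordForm_transition h he he' hz.2.2 (e'.map_target hz.1)
    rwa [e'.right_inv hz.1] at this
  refine
    { isOpen_source := e'.isOpen_inter_preimage_symm (hSo.inter e.open_source)
      isOpen_target := e.isOpen_inter_preimage_symm hSo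
      mapsTo := fun z hz => ⟨e.map_source hz.2.2, by
        change e.symm (e (e'.symm z)) ∈ S
        rw [e.left_inv hz.2.2]; exact hz.2.1⟩
      smooth := fun z hz => transition_contDiffAt he he' hz.1 hz.2.2
      det_jac := fun z hz h0 => ?_
      matSmooth := matSmooth_coordForm he hS
      symm := fun z hz => coordForm_transpose (hS _ hz.2).2.1
      det_ne_zero := fun z hz => det_coordForm_ne_zero he hS hz
      eq_pullback := heq }
  refine det_coordForm_ne_zero he' hS ⟨hz.1, hz.2.1⟩ ?_
  rw [heq z hz, Matrix.det_mul, h0, mul_zero]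

/-- The scalar curvature can be computed in every chart. -/
theorem scal_eq_coordScal {x : M} (hx : IsMetricNear h x) (he : e ∈ atlas (Coord n) M)
    (hxe : x ∈ e.source) : scal h x = coordScal (coordForm h e) (e x) := by
  obtain ⟨S, hSo, hxS, hS⟩ := hx.exists_isOpen
  have hc : x ∈ (chartAt (Coord n) x).source := mem_chart_source _ x
  have hp := isPullback_transition he (chart_mem_atlas (Coord n) x) hSo hS
  have hl := (chartAt (Coord n) x).left_inv hc
  have := hp.coordScal_pullback (y := chartAt (Coord n) x x)
    ⟨(chartAt (Coord n) x).map_source hc, by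
      change (chartAt (Coord n) x).symm (chartAt (Coord n) x x) ∈ S ∩ e.source
      rw [hl]; exact ⟨hxS, hxe⟩⟩
  simp only [hl] at this
  exact this

/-- In every chart, the scalar curvature is the same function `jetScal` of the coordinates of the
`2`-jet. -/
theorem scal_eq_jetScal {x : M} (hx : IsMetricNear h x) (he : e ∈ atlas (Coord n) M)
    (hxe : x ∈ e.source) : scal h x = jetScal (coordJet h x e) := by
  obtain ⟨S, hSo, hxS, hS⟩ := hx.exists_isOpen
  rw [scal_eq_coordScal hx he hxe, coordJet_eq_matJet]
  exact coordScal_eq_jet (e.isOpen_inter_preimage_symm hSo) (matSmooth_coordForm he hS)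
    (fun y hy => det_coordForm_ne_zero he hS hy)
    ⟨e.map_source hxe, by change e.symm (e x) ∈ S; rwa [e.left_inv hxe]⟩

theorem Metr.isGood (g : Metr n M) (x : M) : IsGood g.inner x := (g.isMetricNear x).isGood

theorem Metr.matSmooth (g : Metr n M) (he : e ∈ atlas (Coord n) M) :
    MatSmooth (coordForm g.inner e) e.target := by
  have := matSmooth_coordForm (h := g.inner) he (S := Set.univ) (fun y _ => g.isGood y)
  simpa using this

theorem Metr.det_coordForm_pos (g : Metr n M) (he : e ∈ atlas (Coord n) M) {y : Coord n}
    (hy : y ∈ e.target) : 0 < (coordForm g.inner e y).det := by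
  have := Yamabe.det_coordForm_pos he (e.map_target hy) (g.symm _) (g.pos _)
  rwa [e.right_inv hy] at this

theorem Metr.continuousAt_jetScal_matJet (g : Metr n M) (he : e ∈ atlas (Coord n) M)
    {y : Coord n} (hy : y ∈ e.target) :
    ContinuousAt (fun z => jetScal (matJet (coordForm g.inner e) z)) y := by
  refine ContinuousAt.comp (g := jetScal) (continuousAt_jetScal ?_)
    (continuousAt_matJet (g.matSmooth he) hy)
  exact (g.det_coordForm_pos he hy).ne'

theorem Metr.continuous_scal (g : Metr n M) : Continuous (scal (n := n) (M := M) g.inner) := by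
  refine continuous_iff_continuousAt.2 fun x => ?_
  set e := chartAt (Coord n) x
  have he : e ∈ atlas (Coord n) M := chart_mem_atlas _ x
  have hx : x ∈ e.source := mem_chart_source _ x
  have h1 : ContinuousAt (fun z => jetScal (matJet (coordForm g.inner e) (e z))) x :=
    ContinuousAt.comp (g := fun z => jetScal (matJet (coordForm g.inner e) z))
      (g.continuousAt_jetScal_matJet he (e.map_source hx)) (e.continuousAt hx)
  refine h1.congr ?_
  filter_upwards [e.open_source.mem_nhds hx] with z hz
  rw [scal_eq_jetScal (g.isMetricNear z) he hz, coordJet_eq_matJet]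

theorem inv_stdGram (h : FormField n M) (he : e ∈ atlas (Coord n) M) {x : M} (hx : x ∈ e.source) :
    (stdGram h x)⁻¹ = (stdToChart e x)⁻¹ * (coordForm h e (e x))⁻¹ * ((stdToChart e x)⁻¹)ᵀ := by
  rw [stdGram_eq h he hx, Matrix.mul_inv_rev, Matrix.mul_inv_rev, Matrix.transpose_nonsing_inv,
    Matrix.mul_assoc]

/-- The norm of a covector, computed in the chart `e`. -/
theorem cotangentNormSq_eq_chart {x : M} (hx : IsGood h x) (he : e ∈ atlas (Coord n) M)
    (hxe : x ∈ e.source) (α : TangentSpace (𝓡 n) x →L[ℝ] ℝ) :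
    cotangentNormSq h x α =
      (fun i => α (chartVec e x i)) ⬝ᵥ
        ((coordForm h e (e x))⁻¹ *ᵥ fun i => α (chartVec e x i)) := by
  have hQ : IsUnit (stdToChart e x).det :=
    isUnit_iff_ne_zero.2 (det_stdToChart_ne_zero he hxe hx.2.1 hx.2.2)
  set c : Fin n → ℝ := fun i => α (chartVec e x i) with hc
  have h1 : (fun i => α (stdVec n i)) = (stdToChart e x)ᵀ *ᵥ c := by
    funext i
    have h2 := congrArg α (eq_sum_chartVec he hxe (stdVec n i))
    refine h2.trans ?_
    simp only [map_sum, map_smul, smul_eq_mul]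
    rfl
  rw [cotangentNormSq_eq, h1, inv_stdGram h he hxe, ← Matrix.mulVec_mulVec,
    ← Matrix.mulVec_mulVec, Matrix.mulVec_mulVec c ((stdToChart e x)⁻¹)ᵀ, ← Matrix.transpose_mul,
    Matrix.mul_nonsing_inv _ hQ, Matrix.transpose_one, Matrix.one_mulVec, Matrix.mulVec_transpose,
    ← Matrix.dotProduct_mulVec, Matrix.mulVec_mulVec, Matrix.mul_nonsing_inv _ hQ,
    Matrix.one_mulVec]

theorem differential_chartVec {v : M → ℝ} (hv : ContMDiff (𝓡 n) 𝓘(ℝ, ℝ) ∞ v)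
    (he : e ∈ atlas (Coord n) M) {x : M} (hx : x ∈ e.source) (i : Fin n) :
    differential v x (chartVec e x i) = pd i (fun z => v (e.symm z)) (e x) := by
  have hvd : MDifferentiableAt (𝓡 n) 𝓘(ℝ, ℝ) v (e.symm (e x)) :=
    hv.mdifferentiable (by simp) _
  have hed := (mdifferentiable_chart he).mdifferentiableAt_symm (e.map_source hx)
  have h4 := mfderiv_comp (I := 𝓡 n) (I' := 𝓡 n) (I'' := 𝓘(ℝ, ℝ)) (e x) hvd hed
  have h5 : (mfderiv (𝓡 n) 𝓘(ℝ, ℝ) (v ∘ e.symm) (e x) : Coord n →L[ℝ] ℝ) =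
    (mfderiv (𝓡 n) 𝓘(ℝ, ℝ) v (e.symm (e x)) : Coord n →L[ℝ] ℝ).comp
      (mfderiv (𝓡 n) (𝓡 n) e.symm (e x) : Coord n →L[ℝ] Coord n) := h4
  have h6 : (mfderiv (𝓡 n) 𝓘(ℝ, ℝ) (v ∘ e.symm) (e x) : Coord n →L[ℝ] ℝ) =
    fderiv ℝ (v ∘ e.symm) (e x) := mfderiv_eq_fderiv
  have h7 := congrArg (fun L : Coord n →L[ℝ] ℝ => L (stdVec n i)) (h6.symm.trans h5)
  have h8 : (mfderiv (𝓡 n) 𝓘(ℝ, ℝ) v (e.symm (e x)) : Coord n →L[ℝ] ℝ) =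
    (mfderiv (𝓡 n) 𝓘(ℝ, ℝ) v x : Coord n →L[ℝ] ℝ) := by rw [e.left_inv hx]
  rw [h8] at h7
  exact h7.symm

/-- The squared norm `|dv|_g²` of the differential of a smooth function is continuous. -/
theorem Metr.continuous_cotangentNormSq (g : Metr n M) {v : M → ℝ}
    (hv : ContMDiff (𝓡 n) 𝓘(ℝ, ℝ) ∞ v) :
    Continuous fun x => cotangentNormSq g.inner x (differential v x) := by
  refine continuous_iff_continuousAt.2 fun x => ?_
  set e := chartAt (Coord n) x
  have he : e ∈ atlas (Coord n) M := chart_mem_atlas _ x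
  have hx : x ∈ e.source := mem_chart_source _ x
  have hd : ∀ i, ContinuousAt (fun z => pd i (fun w => v (e.symm w)) (e z)) x := by
    intro i
    refine ContinuousAt.comp (g := pd i (fun w => v (e.symm w))) ?_ (e.continuousAt hx)
    refine (contDiffAt_pd ?_ i).continuousAt
    rw [← contMDiffAt_iff_contDiffAt]
    exact (hv _).comp (e x) (contMDiffAt_chart_symm he (e.map_source hx))
  have hI : ∀ i j, ContinuousAt (fun z => (coordForm g.inner e (e z))⁻¹ i j) x := by
    intro i j
    refine ContinuousAt.comp (g := fun y => (coordForm g.inner e y)⁻¹ i j) ?_ (e.continuousAt hx)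
    exact ((g.matSmooth he).inv (fun y hy => (g.det_coordForm_pos he hy).ne') i j _
      (e.map_source hx)).continuousAt
  have h1 : ContinuousAt (fun z => ∑ i, pd i (fun w => v (e.symm w)) (e z) *
      ∑ j, (coordForm g.inner e (e z))⁻¹ i j * pd j (fun w => v (e.symm w)) (e z)) x := by
    fun_prop
  refine h1.congr ?_
  filter_upwards [e.open_source.mem_nhds hx] with z hz
  rw [cotangentNormSq_eq_chart (g.isGood z) he hz]
  simp only [differential_chartVec hv he hz, dotProduct, Matrix.mulVec]

end Invariants

section Fine

open Matrix

variable {n : ℕ}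

/-! ### Neighbourhoods in the fine topology -/

/-- Positivity of the quadratic form of a (not necessarily symmetric) matrix. -/
def QuadPos (A : Matrix (Fin n) (Fin n) ℝ) : Prop := ∀ ξ : Fin n → ℝ, ξ ≠ 0 → 0 < ξ ⬝ᵥ (A *ᵥ ξ)

theorem QuadPos.congr {A P : Matrix (Fin n) (Fin n) ℝ} (hP : IsUnit P.det) :
    QuadPos (P * A * Pᵀ) ↔ QuadPos A := by
  have key : ∀ (P A : Matrix (Fin n) (Fin n) ℝ), IsUnit P.det → QuadPos A →
      QuadPos (P * A * Pᵀ) := by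
    intro P A hP hA ξ hξ
    have h1 : ξ ⬝ᵥ ((P * A * Pᵀ) *ᵥ ξ) = (Pᵀ *ᵥ ξ) ⬝ᵥ (A *ᵥ (Pᵀ *ᵥ ξ)) := by
      rw [← Matrix.mulVec_mulVec, ← Matrix.mulVec_mulVec, Matrix.dotProduct_mulVec,
        ← Matrix.mulVec_transpose]
    rw [h1]
    refine hA _ fun h0 => hξ ?_
    have hPt : IsUnit (Pᵀ).det := by rwa [Matrix.det_transpose]
    calc ξ = (Pᵀ)⁻¹ *ᵥ (Pᵀ *ᵥ ξ) := by
          rw [Matrix.mulVec_mulVec, Matrix.nonsing_inv_mul _ hPt, Matrix.one_mulVec]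
      _ = 0 := by rw [h0, Matrix.mulVec_zero]
  refine ⟨fun h => ?_, key P A hP⟩
  have h2 := key P⁻¹ _ (by rw [Matrix.isUnit_nonsing_inv_det_iff]; exact hP) h
  have hPt : IsUnit (Pᵀ).det := by rwa [Matrix.det_transpose]
  rwa [Matrix.transpose_nonsing_inv, Matrix.mul_assoc, Matrix.mul_assoc,
    Matrix.mul_nonsing_inv _ hPt, Matrix.mul_one, Matrix.nonsing_inv_mul_cancel_left _ _ hP] at h2

/-- Positivity of quadratic forms is an open condition, by compactness of the unit sphere. -/
theorem QuadPos.eventually {X : Type*} [TopologicalSpace X] {A : X → Matrix (Fin n) (Fin n) ℝ}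
    {x : X} (hA : ContinuousAt A x) (h : QuadPos (A x)) : ∀ᶠ z in 𝓝 x, QuadPos (A z) := by
  have h1 : ∀ᶠ z in 𝓝 x, ∀ ξ ∈ Metric.sphere (0 : Fin n → ℝ) 1, 0 < ξ ⬝ᵥ (A z *ᵥ ξ) := by
    refine (isCompact_sphere (0 : Fin n → ℝ) 1).eventually_forall_of_forall_eventually ?_
    intro ξ hξ
    have hξ0 : ξ ≠ 0 := by
      rintro rfl
      simp at hξ
    have hc : ContinuousAt (fun p : X × (Fin n → ℝ) => p.2 ⬝ᵥ (A p.1 *ᵥ p.2)) (x, ξ) := by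
      have h2 : ContinuousAt (fun p : X × (Fin n → ℝ) => A p.1) (x, ξ) :=
        ContinuousAt.comp (g := A) (f := Prod.fst) hA continuousAt_fst
      have h3 : Continuous fun q : Matrix (Fin n) (Fin n) ℝ × (Fin n → ℝ) =>
          q.2 ⬝ᵥ (q.1 *ᵥ q.2) :=
        continuous_snd.dotProduct (continuous_fst.matrix_mulVec continuous_snd)
      exact ContinuousAt.comp (f := fun p : X × (Fin n → ℝ) => (A p.1, p.2))
        h3.continuousAt (h2.prodMk continuousAt_snd)
    exact hc.eventually (lt_mem_nhds (h ξ hξ0))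
  filter_upwards [h1] with z hz ξ hξ
  have hn : 0 < ‖ξ‖ := norm_pos_iff.2 hξ
  have h4 := hz (‖ξ‖⁻¹ • ξ) (by simp [norm_smul, hn.ne'])
  rw [Matrix.mulVec_smul, smul_dotProduct, dotProduct_smul, smul_eq_mul, smul_eq_mul] at h4
  have h5 : 0 < ‖ξ‖⁻¹ := inv_pos.2 hn
  exact pos_of_mul_pos_right (pos_of_mul_pos_right h4 h5.le) h5.le

variable {M : Type*} [TopologicalSpace M] [ChartedSpace (Coord n) M]

/-- The forms `g` and `h` are `κ`-close at `x`: the induced norms of cotangent vectors, the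
volume densities and the scalar curvatures are. -/
structure CloseAt (g h : FormField n M) (κ : ℝ) (x : M) : Prop where
  lower : QuadPos ((stdGram h x)⁻¹ - (1 - κ) • (stdGram g x)⁻¹)
  upper : QuadPos ((1 + κ) • (stdGram g x)⁻¹ - (stdGram h x)⁻¹)
  scal : |scal h x - scal g x| < κ
  density : |Real.sqrt ((stdGram h x).det / (stdGram g x).det) - 1| < κ

variable [IsManifold (𝓡 n) ∞ M]

/-- The condition of being close to `g`, as a condition on the coordinates of the `2`-jet in the
chart `e`. -/
def closeJets (g : FormField n M) (κ : M → ℝ) (e : OpenPartialHomeomorph M (Coord n)) :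
    Set (JetCoord n) :=
  {z | (z.1 ∈ e.target ∧ (Matrix.of z.2.1).det ≠ 0) ∧
    QuadPos (jetInv z - (1 - κ (e.symm z.1)) • (coordForm g e z.1)⁻¹) ∧
    QuadPos ((1 + κ (e.symm z.1)) • (coordForm g e z.1)⁻¹ - jetInv z) ∧
    |jetScal z - jetScal (matJet (coordForm g e) z.1)| < κ (e.symm z.1) ∧
    |Real.sqrt ((Matrix.of z.2.1).det / (coordForm g e z.1).det) - 1| < κ (e.symm z.1)}

/-- `closeJets` is open: its conditions are strict inequalities and positivity of quadratic forms,
for expressions that depend continuously on the jet wherever the form is nondegenerate. -/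
theorem isOpen_closeJets (g : Metr n M) {κ : M → ℝ} (hκ : Continuous κ)
    {e : OpenPartialHomeomorph M (Coord n)} (he : e ∈ atlas (Coord n) M) :
    IsOpen (closeJets g.inner κ e) := by
  refine isOpen_iff_mem_nhds.2 ?_
  rintro z ⟨⟨hz1, hz2⟩, hz3, hz4, hz5, hz6⟩
  have hfst : ContinuousAt (fun z : JetCoord n => z.1) z := continuousAt_fst
  have hκz : ContinuousAt (fun z : JetCoord n => κ (e.symm z.1)) z :=
    hκ.continuousAt.comp (ContinuousAt.comp (g := e.symm) (e.continuousAt_symm hz1) hfst)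
  have hmat : Continuous fun z : JetCoord n => (Matrix.of z.2.1 : Matrix (Fin n) (Fin n) ℝ) :=
    continuous_snd.fst
  have hdet : ContinuousAt (fun z : JetCoord n => (Matrix.of z.2.1).det) z :=
    hmat.matrix_det.continuousAt
  have hG : ContinuousAt (coordForm g.inner e) z.1 := by
    have h1 : ContinuousAt (fun y => fun i j => coordForm g.inner e y i j) z.1 :=
      continuousAt_pi.2 fun i => continuousAt_pi.2 fun j =>
        (g.matSmooth he i j _ hz1).continuousAt
    exact h1
  have hGd := g.det_coordForm_pos he hz1
  have hGz : ContinuousAt (fun z : JetCoord n => coordForm g.inner e z.1) z :=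
    ContinuousAt.comp (g := coordForm g.inner e) hG hfst
  have hGi : ContinuousAt (fun z : JetCoord n => (coordForm g.inner e z.1)⁻¹) z :=
    continuousAt_inv_entry hGz hGd.ne'
  have hGdet : ContinuousAt (fun z : JetCoord n => (coordForm g.inner e z.1).det) z :=
    ContinuousAt.comp (g := Matrix.det) (continuous_id.matrix_det).continuousAt hGz
  have hI := continuousAt_jetInv hz2
  have hs : ContinuousAt (fun z : JetCoord n =>
      |jetScal z - jetScal (matJet (coordForm g.inner e) z.1)|) z :=
    ((continuousAt_jetScal hz2).sub (ContinuousAt.comp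
      (g := fun y => jetScal (matJet (coordForm g.inner e) y))
      (g.continuousAt_jetScal_matJet he hz1) hfst)).abs
  have hd : ContinuousAt (fun z : JetCoord n =>
      |Real.sqrt ((Matrix.of z.2.1).det / (coordForm g.inner e z.1).det) - 1|) z :=
    (((hdet.div hGdet hGd.ne').sqrt).sub continuousAt_const).abs
  filter_upwards [hfst.eventually (e.open_target.mem_nhds hz1), hdet.eventually_ne hz2,
    QuadPos.eventually (hI.sub ((continuousAt_const.sub hκz).smul hGi)) hz3,
    QuadPos.eventually (((continuousAt_const.add hκz).smul hGi).sub hI) hz4,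
    hs.eventually_lt hκz hz5, hd.eventually_lt hκz hz6] with w h1 h2 h3 h4 h5 h6
  exact ⟨⟨h1, h2⟩, h3, h4, h5, h6⟩

/-- `CloseAt` is a condition on the `2`-jet which can be tested in any chart around the point. -/
theorem coordJet_mem_closeJets_iff (g : Metr n M) (κ : M → ℝ)
    {e : OpenPartialHomeomorph M (Coord n)} (he : e ∈ atlas (Coord n) M) {h : FormField n M}
    {x : M} (hh : IsMetricNear h x) (hx : x ∈ e.source) :
    coordJet h x e ∈ closeJets g.inner κ e ↔ CloseAt g.inner h (κ x) x := by
  have hg := g.isGood x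
  have hhx := hh.isGood
  have hQ0 := det_stdToChart_ne_zero he hx hg.2.1 hg.2.2
  have hP : IsUnit ((stdToChart e x)⁻¹).det := by
    rw [Matrix.isUnit_nonsing_inv_det_iff]; exact isUnit_iff_ne_zero.2 hQ0
  have hdh := det_coordForm_pos he hx hhx.2.1 hhx.2.2
  have h1 : (coordJet h x e).1 = e x := rfl
  have h2 : (Matrix.of (coordJet h x e).2.1 : Matrix (Fin n) (Fin n) ℝ) = coordForm h e (e x) :=
    rfl
  have h3 : jetInv (coordJet h x e) = (coordForm h e (e x))⁻¹ := rfl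
  have hl : (stdGram h x)⁻¹ - (1 - κ x) • (stdGram g.inner x)⁻¹ =
      (stdToChart e x)⁻¹ * ((coordForm h e (e x))⁻¹ - (1 - κ x) • (coordForm g.inner e (e x))⁻¹) *
        ((stdToChart e x)⁻¹)ᵀ := by
    rw [inv_stdGram h he hx, inv_stdGram g.inner he hx, Matrix.mul_sub, Matrix.sub_mul,
      Matrix.mul_smul, Matrix.smul_mul]
  have hu : (1 + κ x) • (stdGram g.inner x)⁻¹ - (stdGram h x)⁻¹ =
      (stdToChart e x)⁻¹ * ((1 + κ x) • (coordForm g.inner e (e x))⁻¹ - (coordForm h e (e x))⁻¹) *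
        ((stdToChart e x)⁻¹)ᵀ := by
    rw [inv_stdGram h he hx, inv_stdGram g.inner he hx, Matrix.mul_sub, Matrix.sub_mul,
      Matrix.mul_smul, Matrix.smul_mul]
  have hs : |scal h x - scal g.inner x| =
      |jetScal (coordJet h x e) - jetScal (matJet (coordForm g.inner e) (e x))| := by
    rw [scal_eq_jetScal hh he hx, scal_eq_jetScal (g.isMetricNear x) he hx]; rfl
  have hd : (stdGram h x).det / (stdGram g.inner x).det =
      (coordForm h e (e x)).det / (coordForm g.inner e (e x)).det := by
    rw [det_stdGram_eq h he hx, det_stdGram_eq g.inner he hx, mul_div_mul_left _ _ (by positivity)]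
  simp only [closeJets, Set.mem_ofPred_eq, h1, h2, h3, e.left_inv hx, e.map_source hx, true_and]
  constructor
  · rintro ⟨-, h4, h5, h6, h7⟩
    refine ⟨?_, ?_, ?_, ?_⟩
    · rw [hl]; exact (QuadPos.congr hP).2 h4
    · rw [hu]; exact (QuadPos.congr hP).2 h5
    · rw [hs]; exact h6
    · rw [hd]; exact h7
  · rintro ⟨h4, h5, h6, h7⟩
    rw [hl] at h4
    rw [hu] at h5
    rw [hs] at h6
    rw [hd] at h7
    exact ⟨hdh.ne', (QuadPos.congr hP).1 h4, (QuadPos.congr hP).1 h5, h6, h7⟩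

/-- The set of jets of metrics that are `κ`-close to `g` at their base point. -/
def closeJetSet (g : Metr n M) (κ : M → ℝ) : Set (JetSpace n M) :=
  {η | ∀ p : PointedMetric n M, Quotient.mk (jetSetoid n M) p = η →
    CloseAt g.inner p.form (κ p.base) p.base}

/-- `closeJetSet` is open in the jet space, since its preimage under every jet chart is given by the
open set `closeJets`. -/
theorem isOpen_closeJetSet (g : Metr n M) {κ : M → ℝ} (hκ : Continuous κ) :
    IsOpen (closeJetSet g κ) := by
  refine isOpen_iSup_iff.2 fun e => ?_
  rw [isOpen_coinduced]
  refine isOpen_induced_iff.2 ⟨closeJets g.inner κ e.1, isOpen_closeJets g hκ e.2, ?_⟩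
  ext ⟨η, hη⟩
  have hchart : ∀ p : PointedMetric n M, Quotient.mk (jetSetoid n M) p = η →
      p.base ∈ e.1.source ∧ JetSpace.chart e η = coordJet p.form p.base e.1 := by
    rintro p rfl
    exact ⟨hη, if_pos hη⟩
  constructor
  · intro h p hp
    obtain ⟨h1, h2⟩ := hchart p hp
    refine (coordJet_mem_closeJets_iff g κ e.2 p.isMetricNear h1).1 ?_
    rw [← h2]; exact h
  · intro h
    obtain ⟨p, hp⟩ := Quotient.exists_rep η
    obtain ⟨h1, h2⟩ := hchart p hp
    change JetSpace.chart e η ∈ closeJets g.inner κ e.1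
    rw [h2]
    exact (coordJet_mem_closeJets_iff g κ e.2 p.isMetricNear h1).2 (h p hp)

theorem closeAt_self (g : Metr n M) {κ : ℝ} (hκ : 0 < κ) (x : M) :
    CloseAt g.inner g.inner κ x := by
  have hp : QuadPos (stdGram g.inner x)⁻¹ := by
    have h := (stdGram_posDef (g.symm x) (g.pos x)).inv
    intro ξ hξ
    simpa using h.dotProduct_mulVec_pos hξ
  have hp2 : QuadPos (κ • (stdGram g.inner x)⁻¹) := by
    intro ξ hξ
    rw [Matrix.smul_mulVec, dotProduct_smul, smul_eq_mul]
    exact mul_pos hκ (hp ξ hξ)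
  refine ⟨?_, ?_, ?_, ?_⟩
  · convert hp2 using 1
    module
  · convert hp2 using 1
    module
  · simpa using hκ
  · rw [div_self (det_stdGram_pos (g.symm x) (g.pos x)).ne']
    simpa using hκ

/-- The metrics that are `κ`-close to `g` form a neighbourhood of `g` in the fine topology, for
every positive continuous function `κ`. -/
theorem eventually_closeAt (g : Metr n M) {κ : M → ℝ} (hκ : Continuous κ) (hpos : ∀ x, 0 < κ x) :
    ∀ᶠ h in @nhds (Metr n M) (fineC2Topology n M) g, ∀ x, CloseAt g.inner h.inner (κ x) x := by
  let _ := fineC2Topology n M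
  have hopen : IsOpen {h : Metr n M | Set.range (jet h) ⊆ closeJetSet g κ} :=
    TopologicalSpace.isOpen_generateFrom_of_mem ⟨_, isOpen_closeJetSet g hκ, rfl⟩
  have hmem : g ∈ {h : Metr n M | Set.range (jet h) ⊆ closeJetSet g κ} := by
    rintro _ ⟨x, rfl⟩ p hp
    have h1 : (jetSetoid n M).r p ⟨x, g.inner, g.isMetricNear x⟩ := Quotient.exact hp
    have h2 : p.base = x := h1.1
    obtain ⟨y, f, hf⟩ := p
    obtain rfl : y = x := h2
    have hc := mem_chart_source (Coord n) y
    have ha := chart_mem_atlas (Coord n) y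
    refine (coordJet_mem_closeJets_iff g κ ha hf hc).1 ?_
    have h3 := h1.2 _ ha hc
    simp only at h3
    rw [h3]
    exact (coordJet_mem_closeJets_iff g κ ha (g.isMetricNear y) hc).2 (closeAt_self g (hpos y) y)
  filter_upwards [hopen.mem_nhds hmem] with h hh x
  exact hh ⟨x, rfl⟩ ⟨x, h.inner, h.isMetricNear x⟩ rfl

end Fine

section Volume

open Matrix MeasureTheory

variable {n : ℕ}

/-! ### The volume measure -/

theorem measurableSet_target_inter_preimage {M : Type*} [TopologicalSpace M]
    [MeasurableSpace M] [BorelSpace M] {e : OpenPartialHomeomorph M (Coord n)} {A : Set M}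
    (hA : MeasurableSet A) :
    MeasurableSet (e.target ∩ e.symm ⁻¹' A) := by
  have h1 : Measurable (e.target.domRestrict e.symm) :=
    (continuousOn_iff_continuous_domRestrict.1 e.continuousOn_symm).measurable
  have h2 := e.open_target.measurableSet.subtype_image (h1 hA)
  convert h2 using 1
  ext y
  constructor
  · rintro ⟨h3, h4⟩
    exact ⟨⟨y, h3⟩, h4, rfl⟩
  · rintro ⟨⟨z, hz⟩, h4, rfl⟩
    exact ⟨hz, h4⟩

variable {M : Type*} [TopologicalSpace M] [ChartedSpace (Coord n) M]

/-- The volume density of `g` in the chart `e`. -/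
def chartDensity (g : FormField n M) (e : OpenPartialHomeomorph M (Coord n)) (y : Coord n) : ℝ :=
  Real.sqrt (coordForm g e y).det

/-- The density of the volume measure of `h` with respect to the one of `g`. -/
def relDensity (g h : FormField n M) (x : M) : ℝ :=
  Real.sqrt ((stdGram h x).det / (stdGram g x).det)

theorem det_fderiv_eq_det_jac {τ : Coord n → Coord n} {y : Coord n}
    (hτ : DifferentiableAt ℝ τ y) : (fderiv ℝ τ y).det = (jac τ y).det := by
  have h := LinearMap.det_toMatrix (EuclideanSpace.basisFun (Fin n) ℝ).toBasis
    (fderiv ℝ τ y : Coord n →ₗ[ℝ] Coord n)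
  rw [ContinuousLinearMap.det, ← h]
  congr 1
  ext i j
  rw [LinearMap.toMatrix_apply]
  simp only [OrthonormalBasis.coe_toBasis, EuclideanSpace.basisFun_apply,
    OrthonormalBasis.coe_toBasis_repr_apply, EuclideanSpace.basisFun_repr]
  exact fderiv_apply_coord hτ _ _

theorem chartVolume_le_riemVolume [MeasurableSpace M] (g : FormField n M)
    {e : OpenPartialHomeomorph M (Coord n)}
    (he : e ∈ atlas (Coord n) M) :
    chartVolume g e ≤ riemVolume g :=
  le_iSup₂ (f := fun e (_ : e ∈ atlas (Coord n) M) => chartVolume g e) e he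

variable [IsManifold (𝓡 n) ∞ M] {e e' : OpenPartialHomeomorph M (Coord n)}

theorem continuousOn_chartDensity (g : Metr n M) (he : e ∈ atlas (Coord n) M) :
    ContinuousOn (chartDensity g.inner e) e.target := by
  intro y hy
  exact ((contDiffAt_det (g.matSmooth he) hy).continuousAt.sqrt).continuousWithinAt

theorem chartDensity_pos (g : Metr n M) (he : e ∈ atlas (Coord n) M) {y : Coord n}
    (hy : y ∈ e.target) : 0 < chartDensity g.inner e y :=
  Real.sqrt_pos.2 (g.det_coordForm_pos he hy)

theorem relDensity_pos (g h : Metr n M) (x : M) : 0 < relDensity g.inner h.inner x :=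
  Real.sqrt_pos.2 (div_pos (det_stdGram_pos (h.symm x) (h.pos x))
    (det_stdGram_pos (g.symm x) (g.pos x)))

theorem relDensity_mul_relDensity (g h : Metr n M) (x : M) :
    relDensity g.inner h.inner x * relDensity h.inner g.inner x = 1 := by
  have h1 := det_stdGram_pos (h.symm x) (h.pos x)
  have h2 := det_stdGram_pos (g.symm x) (g.pos x)
  rw [relDensity, relDensity, ← Real.sqrt_mul (div_pos h1 h2).le, div_mul_div_comm, mul_comm,
    div_self (mul_pos h2 h1).ne', Real.sqrt_one]

theorem chartDensity_eq_relDensity_mul (g h : Metr n M) (he : e ∈ atlas (Coord n) M)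
    {x : M} (hx : x ∈ e.source) :
    chartDensity h.inner e (e x) = relDensity g.inner h.inner x * chartDensity g.inner e (e x) := by
  have h1 := g.det_coordForm_pos he (e.map_source hx)
  have h2 := h.det_coordForm_pos he (e.map_source hx)
  have hQ := det_stdToChart_ne_zero he hx (g.symm x) (g.pos x)
  rw [relDensity, chartDensity, chartDensity, det_stdGram_eq h.inner he hx,
    det_stdGram_eq g.inner he hx, mul_div_mul_left _ _ (by positivity),
    ← Real.sqrt_mul (div_pos h2 h1).le, div_mul_cancel₀ _ h1.ne']

theorem continuous_relDensity (g h : Metr n M) :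
    Continuous (relDensity (n := n) (M := M) g.inner h.inner) := by
  refine continuous_iff_continuousAt.2 fun x => ?_
  set e := chartAt (Coord n) x
  have he : e ∈ atlas (Coord n) M := chart_mem_atlas _ x
  have hx : x ∈ e.source := mem_chart_source _ x
  have hc : ∀ g : Metr n M, ContinuousAt (fun z => chartDensity g.inner e (e z)) x := fun g =>
    ContinuousAt.comp (g := chartDensity g.inner e) ((continuousOn_chartDensity g he).continuousAt
      (e.open_target.mem_nhds (e.map_source hx))) (e.continuousAt hx)
  refine ((hc h).div (hc g) (chartDensity_pos g he (e.map_source hx)).ne').congr ?_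
  filter_upwards [e.open_source.mem_nhds hx] with z hz
  rw [Pi.div_apply, chartDensity_eq_relDensity_mul g h he hz,
    mul_div_cancel_right₀ _ (chartDensity_pos g he (e.map_source hz)).ne']

variable [MeasurableSpace M] [BorelSpace M]

/-- Integration with respect to the volume measure of a chart, written in coordinates. -/
theorem lintegral_chartVolume (g : Metr n M) (he : e ∈ atlas (Coord n) M) {F : M → ENNReal}
    (hF : Measurable F) : ∫⁻ x, F x ∂(chartVolume g.inner e) =
      ∫⁻ y in e.target, ENNReal.ofReal (chartDensity g.inner e y) * F (e.symm y) := by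
  have hs : AEMeasurable e.symm (volume.restrict e.target) :=
    e.continuousOn_symm.aemeasurable e.open_target.measurableSet
  have hd : AEMeasurable (fun y => ENNReal.ofReal (chartDensity g.inner e y))
      (volume.restrict e.target) :=
    ((continuousOn_chartDensity g he).aemeasurable e.open_target.measurableSet).ennreal_ofReal
  have hs' := hs.mono_ac (withDensity_absolutelyContinuous _
    (fun y => ENNReal.ofReal (chartDensity g.inner e y)))
  change ∫⁻ x, F x ∂(((volume.restrict e.target).withDensity
    fun y => ENNReal.ofReal (chartDensity g.inner e y)).map e.symm) = _
  rw [lintegral_map' hF.aemeasurable hs']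
  exact lintegral_withDensity_eq_lintegral_mul₀ hd (hF.comp_aemeasurable hs)

theorem chartVolume_apply (g : Metr n M) (he : e ∈ atlas (Coord n) M) {A : Set M}
    (hA : MeasurableSet A) : chartVolume g.inner e A =
      ∫⁻ y in e.target ∩ e.symm ⁻¹' A, ENNReal.ofReal (chartDensity g.inner e y) := by
  have h1 := lintegral_chartVolume g he (F := A.indicator 1) (measurable_one.indicator hA)
  rw [lintegral_indicator_one hA] at h1
  rw [h1, ← lintegral_indicator e.open_target.measurableSet,
    ← lintegral_indicator (measurableSet_target_inter_preimage hA)]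
  refine lintegral_congr fun y => ?_
  by_cases hy : y ∈ e.target <;> by_cases hyA : e.symm y ∈ A <;>
    simp [Set.indicator, hy, hyA]

/-- The volume measures given by two charts agree where both charts are defined, by the change of
variables formula. -/
theorem chartVolume_eq_of_subset (g : Metr n M) (he : e ∈ atlas (Coord n) M)
    (he' : e' ∈ atlas (Coord n) M) {A : Set M} (hA : MeasurableSet A) (hAe : A ⊆ e.source)
    (hAe' : A ⊆ e'.source) : chartVolume g.inner e A = chartVolume g.inner e' A := by
  set τ : Coord n → Coord n := fun z => e (e'.symm z) with hτ
  set s := e'.target ∩ e'.symm ⁻¹' A with hs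
  have himg : τ '' s = e.target ∩ e.symm ⁻¹' A := by
    ext y
    constructor
    · rintro ⟨z, ⟨hz, hzA⟩, rfl⟩
      refine ⟨e.map_source (hAe hzA), ?_⟩
      change e.symm (e (e'.symm z)) ∈ A
      rw [e.left_inv (hAe hzA)]; exact hzA
    · rintro ⟨hy, hyA⟩
      refine ⟨e' (e.symm y), ⟨e'.map_source (hAe' hyA), ?_⟩, ?_⟩
      · change e'.symm (e' (e.symm y)) ∈ A
        rw [e'.left_inv (hAe' hyA)]; exact hyA
      · simp only [hτ, e'.left_inv (hAe' hyA), e.right_inv hy]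
  have hd : ∀ z ∈ s, DifferentiableAt ℝ τ z := fun z hz =>
    (transition_contDiffAt he he' hz.1 (hAe hz.2)).differentiableAt (by simp)
  have hinj : Set.InjOn τ s := by
    rintro y ⟨hy, hyA⟩ z ⟨hz, hzA⟩ hyz
    have h1 := e.injOn (hAe hyA) (hAe hzA) hyz
    exact e'.symm.injOn hy hz h1
  rw [chartVolume_apply g he hA, chartVolume_apply g he' hA, ← himg,
    lintegral_image_eq_lintegral_abs_det_fderiv_mul volume
      (measurableSet_target_inter_preimage hA)
      (fun z hz => (hd z hz).hasFDerivAt.hasFDerivWithinAt) hinj]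
  refine setLIntegral_congr_fun (measurableSet_target_inter_preimage hA) fun z hz => ?_
  have h2 := coordForm_transition g.inner he he' (hAe hz.2) (e'.map_target hz.1)
  rw [e'.right_inv hz.1] at h2
  simp only [chartDensity]
  rw [h2, det_fderiv_eq_det_jac (hd z hz), ← ENNReal.ofReal_mul (abs_nonneg _), Matrix.det_mul,
    Matrix.det_mul, Matrix.det_transpose]
  congr 1
  rw [mul_right_comm, ← sq, Real.sqrt_mul (sq_nonneg _), Real.sqrt_sq_eq_abs]

/-- On the domain of a chart, the Riemannian volume is the volume given by this chart. -/
theorem riemVolume_apply_of_subset (g : Metr n M) (he : e ∈ atlas (Coord n) M) {A : Set M}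
    (hA : MeasurableSet A) (hAe : A ⊆ e.source) :
    riemVolume g.inner A = chartVolume g.inner e A := by
  refine le_antisymm ?_ (chartVolume_le_riemVolume g.inner he A)
  have hle : riemVolume g.inner ≤
      chartVolume g.inner e + (riemVolume g.inner).restrict e.sourceᶜ := by
    refine iSup₂_le fun e' he' => Measure.le_iff.2 fun B hB => ?_
    rw [← measure_inter_add_sdiff B e.open_source.measurableSet, Measure.add_apply]
    have hsub : ∀ C : Set M, MeasurableSet C →
        chartVolume g.inner e' C = chartVolume g.inner e' (C ∩ e'.source) := by
      intro C hC
      rw [chartVolume_apply g he' hC, chartVolume_apply g he'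
        (hC.inter e'.open_source.measurableSet)]
      congr 2
      ext y
      constructor
      · rintro ⟨h1, h2⟩
        exact ⟨h1, h2, e'.map_target h1⟩
      · rintro ⟨h1, h2, -⟩
        exact ⟨h1, h2⟩
    refine add_le_add ?_ ?_
    · rw [hsub _ (hB.inter e.open_source.measurableSet), ← chartVolume_eq_of_subset g he he'
        ((hB.inter e.open_source.measurableSet).inter e'.open_source.measurableSet)
        (fun x hx => hx.1.2) (fun x hx => hx.2)]
      exact measure_mono fun x hx => hx.1.1
    · rw [Measure.restrict_apply hB]
      exact chartVolume_le_riemVolume g.inner he' _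
  refine (hle A).trans ?_
  rw [Measure.add_apply, Measure.restrict_apply hA]
  have : A ∩ e.sourceᶜ = ∅ := by
    ext x; simp only [Set.mem_inter_iff, Set.mem_compl_iff, Set.mem_empty_iff_false, iff_false]
    exact fun h => h.2 (hAe h.1)
  simp [this]

/-- Compact neighbourhoods inside a chart domain have finite volume, because the density is
continuous in the chart. -/
instance isLocallyFiniteMeasure_riemVolume [T2Space M] (g : Metr n M) :
    IsLocallyFiniteMeasure (riemVolume (n := n) (M := M) g.inner) := by
  refine ⟨fun x => ?_⟩
  set e := chartAt (Coord n) x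
  have he : e ∈ atlas (Coord n) M := chart_mem_atlas _ x
  have hx : x ∈ e.source := mem_chart_source _ x
  obtain ⟨C, hCn, hCt, hC⟩ := local_compact_nhds (e.open_target.mem_nhds (e.map_source hx))
  have hK : IsCompact (e.symm '' C) := hC.image_of_continuousOn (e.continuousOn_symm.mono hCt)
  refine ⟨e.symm '' C, ?_, ?_⟩
  · have h1 := e.symm.image_mem_nhds (e.map_source hx) hCn
    rwa [e.left_inv hx] at h1
  · have hsub : e.symm '' C ⊆ e.source := by
      rintro _ ⟨y, hy, rfl⟩
      exact e.map_target (hCt hy)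
    rw [riemVolume_apply_of_subset g he hK.measurableSet hsub,
      chartVolume_apply g he hK.measurableSet]
    have h2 : e.target ∩ e.symm ⁻¹' (e.symm '' C) = C := by
      ext y
      constructor
      · rintro ⟨hy, z, hz, hzy⟩
        rwa [← e.symm.injOn (hCt hz) hy hzy]
      · exact fun hy => ⟨hCt hy, y, hy, rfl⟩
    rw [h2]
    exact (((continuousOn_chartDensity g he).mono hCt).integrableOn_compact hC).lintegral_lt_top

/-- Nonempty open sets have positive volume, because the density is positive in every chart. -/
instance isOpenPosMeasure_riemVolume (g : Metr n M) :
    (riemVolume (n := n) (M := M) g.inner).IsOpenPosMeasure := by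
  refine ⟨fun U hU ⟨x, hxU⟩ h0 => ?_⟩
  set e := chartAt (Coord n) x
  have he : e ∈ atlas (Coord n) M := chart_mem_atlas _ x
  have hx : x ∈ e.source := mem_chart_source _ x
  have h1 : chartVolume g.inner e U = 0 :=
    le_antisymm ((chartVolume_le_riemVolume g.inner he U).trans h0.le) bot_le
  have hVo : IsOpen (e.target ∩ e.symm ⁻¹' U) := e.isOpen_inter_preimage_symm hU
  have hm : AEMeasurable (fun y => ENNReal.ofReal (chartDensity g.inner e y))
      (volume.restrict (e.target ∩ e.symm ⁻¹' U)) :=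
    (((continuousOn_chartDensity g he).mono Set.inter_subset_left).aemeasurable
      hVo.measurableSet).ennreal_ofReal
  rw [chartVolume_apply g he hU.measurableSet, lintegral_eq_zero_iff' hm] at h1
  have h2 : ∀ᵐ y ∂volume.restrict (e.target ∩ e.symm ⁻¹' U), False := by
    filter_upwards [h1, ae_restrict_mem hVo.measurableSet] with y hy hyV
    have := chartDensity_pos g he hyV.1
    have h3 : ENNReal.ofReal (chartDensity g.inner e y) = 0 := hy
    rw [ENNReal.ofReal_eq_zero] at h3
    linarith
  have h4 : volume (e.target ∩ e.symm ⁻¹' U) = 0 := by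
    rw [← Measure.restrict_eq_zero]
    exact ae_eq_bot.1 (Filter.eventually_false_iff_eq_bot.1 h2)
  refine (hVo.measure_pos volume ⟨e x, e.map_source hx, ?_⟩).ne' h4
  change e.symm (e x) ∈ U
  rwa [e.left_inv hx]

theorem chartVolume_eq_withDensity (g h : Metr n M) (he : e ∈ atlas (Coord n) M) :
    chartVolume h.inner e = (chartVolume g.inner e).withDensity
      fun x => ENNReal.ofReal (relDensity g.inner h.inner x) := by
  have hr : Measurable fun x => ENNReal.ofReal (relDensity g.inner h.inner x) :=
    (continuous_relDensity g h).measurable.ennreal_ofReal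
  refine Measure.ext fun A hA => ?_
  rw [withDensity_apply _ hA, ← lintegral_indicator hA, lintegral_chartVolume g he
    (hr.indicator hA), ← lintegral_indicator_one hA, lintegral_chartVolume h he
    (measurable_one.indicator hA)]
  refine setLIntegral_congr_fun e.open_target.measurableSet fun y hy => ?_
  have h1 := chartDensity_eq_relDensity_mul g h he (e.map_target hy)
  rw [e.right_inv hy] at h1
  by_cases hyA : e.symm y ∈ A
  · simp only [Set.indicator_of_mem hyA, Pi.one_apply, mul_one]
    rw [h1, mul_comm, ENNReal.ofReal_mul (chartDensity_pos g he hy).le]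
  · simp only [Set.indicator_of_notMem hyA, mul_zero]

/-- One inequality suffices for `riemVolume_eq_withDensity`: applied to `(h, g)` it gives the other
one, since the relative densities are inverse to each other. -/
theorem riemVolume_le_withDensity (g h : Metr n M) :
    riemVolume h.inner ≤ (riemVolume g.inner).withDensity
      fun x => ENNReal.ofReal (relDensity g.inner h.inner x) := by
  refine iSup₂_le fun e he => ?_
  rw [chartVolume_eq_withDensity g h he]
  refine Measure.le_iff.2 fun A hA => ?_
  rw [withDensity_apply _ hA, withDensity_apply _ hA]
  exact lintegral_mono' (Measure.restrict_mono le_rfl (chartVolume_le_riemVolume g.inner he)) le_rfl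

/-- The volume measures of two metrics differ by the continuous density `relDensity`. -/
theorem riemVolume_eq_withDensity (g h : Metr n M) :
    riemVolume h.inner = (riemVolume g.inner).withDensity
      fun x => ENNReal.ofReal (relDensity g.inner h.inner x) := by
  refine le_antisymm (riemVolume_le_withDensity g h) ?_
  have hr : ∀ g h : Metr n M, Measurable fun x => ENNReal.ofReal (relDensity g.inner h.inner x) :=
    fun g h => (continuous_relDensity g h).measurable.ennreal_ofReal
  have h1 := riemVolume_le_withDensity h g
  refine Measure.le_iff.2 fun A hA => ?_
  rw [withDensity_apply _ hA]
  calc ∫⁻ x in A, ENNReal.ofReal (relDensity g.inner h.inner x) ∂riemVolume g.inner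
      ≤ ∫⁻ x in A, ENNReal.ofReal (relDensity g.inner h.inner x)
          ∂((riemVolume h.inner).withDensity
            fun x => ENNReal.ofReal (relDensity h.inner g.inner x)) :=
        lintegral_mono' (Measure.restrict_mono le_rfl h1) le_rfl
    _ = ∫⁻ x in A, 1 ∂riemVolume h.inner := by
        rw [setLIntegral_withDensity_eq_setLIntegral_mul _ (hr h g) (hr g h) hA]
        refine setLIntegral_congr_fun hA fun x _ => ?_
        simp only [Pi.mul_apply]
        rw [← ENNReal.ofReal_mul (relDensity_pos h g x).le, relDensity_mul_relDensity,
          ENNReal.ofReal_one]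
    _ = riemVolume h.inner A := by simp

theorem integral_riemVolume (g h : Metr n M) (f : M → ℝ) :
    ∫ x, f x ∂riemVolume h.inner =
      ∫ x, relDensity g.inner h.inner x * f x ∂riemVolume g.inner := by
  rw [riemVolume_eq_withDensity g h]
  have h1 : (fun x => ENNReal.ofReal (relDensity g.inner h.inner x)) =
      fun x => ((relDensity g.inner h.inner x).toNNReal : ENNReal) := rfl
  rw [h1, integral_withDensity_eq_integral_smul
    (continuous_relDensity g h).measurable.real_toNNReal]
  refine integral_congr_ae (Filter.Eventually.of_forall fun x => ?_)
  simp only [NNReal.smul_def, smul_eq_mul, Real.coe_toNNReal _ (relDensity_pos g h x).le]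

end Volume

section Gradient

open Matrix MeasureTheory

/-! ### The energy density -/

/-- The weighted inequality behind the localization argument: for a positive semidefinite form `B`,
it bounds the form at `(1 - κ) α - r β`, where `κ = ∑ cᵢ tᵢ²` and `β = ∑ 2 cᵢ tᵢ γᵢ`. -/
theorem bilin_localization {V ι : Type*} [AddCommGroup V] [Module ℝ V] (B : LinearMap.BilinForm ℝ V)
    (hB : ∀ x, 0 ≤ B x x) (hs : ∀ x y, B x y = B y x) (s : Finset ι) {c t : ι → ℝ}
    (hc : ∀ i, 0 ≤ c i) (γ : ι → V) (α : V) (r : ℝ) (hκ : ∑ i ∈ s, c i * t i ^ 2 ≤ 1) :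
    B ((1 - ∑ i ∈ s, c i * t i ^ 2) • α - r • ∑ i ∈ s, (2 * c i * t i) • γ i)
        ((1 - ∑ i ∈ s, c i * t i ^ 2) • α - r • ∑ i ∈ s, (2 * c i * t i) • γ i) ≤
      (1 - ∑ i ∈ s, c i * t i ^ 2) * B α α + 8 * r ^ 2 * ∑ i ∈ s, c i * B (γ i) (γ i) := by
  set κ := ∑ i ∈ s, c i * t i ^ 2 with hκdef
  set β := ∑ i ∈ s, (2 * c i * t i) • γ i with hβ
  set T := ∑ i ∈ s, c i * B (γ i) (γ i) with hT
  have amgm : ∀ x y : V, 2 * B x y ≤ B x x + B y y := by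
    intro x y
    have h := hB (x - y)
    simp only [map_sub, LinearMap.sub_apply] at h
    rw [hs y x] at h
    linarith
  have hκ0 : 0 ≤ κ := Finset.sum_nonneg fun i _ => mul_nonneg (hc i) (sq_nonneg _)
  have hT0 : 0 ≤ T := Finset.sum_nonneg fun i _ => mul_nonneg (hc i) (hB _)
  have hexp : ∀ x, B x β = ∑ i ∈ s, c i * (2 * t i * B x (γ i)) := by
    intro x
    simp only [hβ, map_sum, map_smul, smul_eq_mul]
    exact Finset.sum_congr rfl fun i _ => by ring
  -- the mixed term
  have h1 : -(2 * r * B α β) ≤ κ * B α α + 4 * r ^ 2 * T := by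
    rw [hexp, hκdef, hT, Finset.sum_mul, Finset.mul_sum, Finset.mul_sum, ← Finset.sum_neg_distrib,
      ← Finset.sum_add_distrib]
    refine Finset.sum_le_sum fun i _ => ?_
    have h := amgm (t i • α) (-(2 * r) • γ i)
    simp only [map_smul, LinearMap.smul_apply, smul_eq_mul] at h
    nlinarith [mul_le_mul_of_nonneg_left h (hc i)]
  -- the quadratic term is absorbed into the left-hand side
  have h2 : B β β ≤ 4 * T := by
    have h3 : B β β ≤ κ / 2 * B β β + 2 * T := by
      conv_lhs => rw [hexp]
      rw [hκdef, hT, div_mul_eq_mul_div, Finset.sum_mul, Finset.mul_sum, Finset.sum_div,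
        ← Finset.sum_add_distrib]
      refine Finset.sum_le_sum fun i _ => ?_
      have h := amgm (t i • β) ((2 : ℝ) • γ i)
      simp only [map_smul, LinearMap.smul_apply, smul_eq_mul] at h
      nlinarith [mul_le_mul_of_nonneg_left h (hc i)]
    nlinarith [hB β]
  have hexpand : B ((1 - κ) • α - r • β) ((1 - κ) • α - r • β) =
      (1 - κ) ^ 2 * B α α - (1 - κ) * (2 * r * B α β) + r ^ 2 * B β β := by
    simp only [map_sub, map_smul, LinearMap.sub_apply, LinearMap.smul_apply, smul_eq_mul]
    rw [hs β α]; ring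
  rw [hexpand]
  have h4 := mul_le_mul_of_nonneg_left h1 (sub_nonneg.2 hκ)
  have h5 := mul_le_mul_of_nonneg_left h2 (sq_nonneg r)
  nlinarith [mul_nonneg (mul_nonneg hκ0 (sq_nonneg r)) hT0]

/-- The comparison of the energy densities of two nearby metrics. -/
theorem abs_density_sub_le {a G H S S' r k u : ℝ} (ha : 0 ≤ a) (hG : 0 ≤ G) (hu : 0 ≤ u)
    (hk0 : 0 ≤ k) (hk : k ≤ 1) (h1 : (1 - k) * G ≤ H) (h2 : H ≤ (1 + k) * G)
    (hS : |S' - S| ≤ k) (hr : |r - 1| ≤ k) :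
    |r * (a * H + S' * u) - (a * G + S * u)| ≤ k * (3 * a * G + (|S| + 2) * u) := by
  have hr' := abs_le.1 hr
  have hr0 : 0 ≤ r := by linarith
  have e1 : |r * H - G| ≤ 3 * k * G := by
    rw [abs_le]
    constructor
    · nlinarith [mul_le_mul_of_nonneg_left h1 hr0, mul_nonneg hk0 hG,
        mul_nonneg (mul_nonneg (sub_nonneg.2 hk) hG) (by linarith : 0 ≤ r - (1 - k))]
    · nlinarith [mul_le_mul_of_nonneg_left h2 hr0, mul_nonneg hk0 hG,
        mul_nonneg (mul_nonneg (by linarith : 0 ≤ 1 + k) hG) (by linarith : 0 ≤ (1 + k) - r),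
        mul_nonneg (mul_nonneg hk0 hG) (sub_nonneg.2 hk)]
  have e2 : |r * S' - S| ≤ k * (|S| + 2) := by
    have : r * S' - S = r * (S' - S) + (r - 1) * S := by ring
    rw [this]
    refine (abs_add_le _ _).trans ?_
    rw [abs_mul, abs_mul, abs_of_nonneg hr0]
    nlinarith [mul_le_mul_of_nonneg_right hr (abs_nonneg S), mul_le_mul_of_nonneg_left hS hr0]
  have e3 : r * (a * H + S' * u) - (a * G + S * u) = a * (r * H - G) + (r * S' - S) * u := by ring
  rw [e3]
  refine (abs_add_le _ _).trans ?_
  rw [abs_mul, abs_mul, abs_of_nonneg ha, abs_of_nonneg hu]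
  nlinarith [mul_le_mul_of_nonneg_left e1 ha, mul_le_mul_of_nonneg_right e2 hu]

variable {n : ℕ} {M : Type*} [TopologicalSpace M] [ChartedSpace (Coord n) M]

/-- The components of the differential of `v` in the standard frame. -/
def stdDiff (v : M → ℝ) (x : M) : Fin n → ℝ := fun i => differential (n := n) v x (stdVec n i)

/-- The squared norm `|dv|_g²`. -/
def gradSq (g : FormField n M) (v : M → ℝ) (x : M) : ℝ :=
  cotangentNormSq g x (differential v x)

theorem gradSq_eq (g : FormField n M) (v : M → ℝ) (x : M) :
    gradSq g v x = Matrix.toBilin' (stdGram g x)⁻¹ (stdDiff v x) (stdDiff v x) := by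
  rw [Matrix.toBilin'_apply']
  exact cotangentNormSq_eq g x _

theorem stdDiff_eq_zero {v : M → ℝ} {x : M} (hx : x ∉ tsupport v) :
    stdDiff (n := n) v x = 0 := by
  have h : v =ᶠ[𝓝 x] fun _ => 0 := notMem_tsupport_iff_eventuallyEq.1 hx
  have h1 : mfderiv (𝓡 n) 𝓘(ℝ, ℝ) v x = (mfderiv (𝓡 n) 𝓘(ℝ, ℝ) (fun _ : M => (0 : ℝ)) x : _) :=
    h.mfderiv_eq
  funext i
  have h2 : differential (n := n) v x (stdVec n i) =
      differential (n := n) (fun _ : M => (0 : ℝ)) x (stdVec n i) :=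
    congrArg (fun L : Coord n →L[ℝ] ℝ => L (stdVec n i)) h1
  have h3 : (mfderiv (𝓡 n) 𝓘(ℝ, ℝ) (fun _ : M => (0 : ℝ)) x : Coord n →L[ℝ] ℝ) = 0 :=
    mfderiv_const
  refine h2.trans ?_
  exact congrArg (fun L : Coord n →L[ℝ] ℝ => L (stdVec n i)) h3

theorem gradSq_eq_zero (g : FormField n M) {v : M → ℝ} {x : M} (hx : x ∉ tsupport v) :
    gradSq g v x = 0 := by
  rw [gradSq_eq, stdDiff_eq_zero hx]; simp

theorem CloseAt.gradSq_bounds {g h : FormField n M} {κ : ℝ} {x : M} (hc : CloseAt g h κ x)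
    (v : M → ℝ) : (1 - κ) * gradSq g v x ≤ gradSq h v x ∧
      gradSq h v x ≤ (1 + κ) * gradSq g v x := by
  simp only [gradSq_eq, Matrix.toBilin'_apply']
  by_cases h0 : stdDiff (n := n) v x = 0
  · simp [h0]
  · have h1 := hc.lower _ h0
    have h2 := hc.upper _ h0
    rw [Matrix.sub_mulVec, Matrix.smul_mulVec, dotProduct_sub, dotProduct_smul, smul_eq_mul]
      at h1 h2
    exact ⟨by linarith, by linarith⟩

variable [IsManifold (𝓡 n) ∞ M]

theorem stdDiff_apply_eq_sum {v : M → ℝ} (hv : ContMDiff (𝓡 n) 𝓘(ℝ, ℝ) ∞ v) (x : M) (i : Fin n) :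
    stdDiff v x i = ∑ a, stdToChart (chartAt (Coord n) x) x a i *
      pd a (fun z => v ((chartAt (Coord n) x).symm z)) (chartAt (Coord n) x x) := by
  have he := chart_mem_atlas (Coord n) x
  have hx := mem_chart_source (Coord n) x
  have h1 := congrArg (differential v x) (eq_sum_chartVec he hx (stdVec n i))
  refine h1.trans ?_
  simp only [map_sum, map_smul, smul_eq_mul, differential_chartVec hv he hx]
  rfl

theorem differentiableAt_comp_chart_symm {v : M → ℝ} (hv : ContMDiff (𝓡 n) 𝓘(ℝ, ℝ) ∞ v) (x : M) :
    DifferentiableAt ℝ (fun z => v ((chartAt (Coord n) x).symm z)) (chartAt (Coord n) x x) := by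
  refine differentiableAt_of_contDiffAt_infty ?_
  rw [← contMDiffAt_iff_contDiffAt]
  exact (hv _).comp _ (contMDiffAt_chart_symm (chart_mem_atlas (Coord n) x)
    ((chartAt (Coord n) x).map_source (mem_chart_source (Coord n) x)))

theorem stdDiff_mul {u v : M → ℝ} (hu : ContMDiff (𝓡 n) 𝓘(ℝ, ℝ) ∞ u)
    (hv : ContMDiff (𝓡 n) 𝓘(ℝ, ℝ) ∞ v) (x : M) :
    stdDiff (n := n) (fun z => u z * v z) x = u x • stdDiff v x + v x • stdDiff u x := by
  funext i
  have hl := (chartAt (Coord n) x).left_inv (mem_chart_source (Coord n) x)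
  rw [stdDiff_apply_eq_sum (v := fun z => u z * v z) (hu.mul hv)]
  simp only [Pi.add_apply, Pi.smul_apply, smul_eq_mul, stdDiff_apply_eq_sum hu,
    stdDiff_apply_eq_sum hv, Finset.mul_sum]
  rw [← Finset.sum_add_distrib]
  refine Finset.sum_congr rfl fun a _ => ?_
  rw [pd_mul (differentiableAt_comp_chart_symm hu x) (differentiableAt_comp_chart_symm hv x), hl]
  ring

theorem stdDiff_one_sub_sum_sq {ι : Type*} (s : Finset ι) (c : ι → ℝ) {ρ : ι → M → ℝ}
    (hρ : ∀ i, ContMDiff (𝓡 n) 𝓘(ℝ, ℝ) ∞ (ρ i)) (x : M) :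
    stdDiff (n := n) (fun z => 1 - ∑ i ∈ s, c i * ρ i z ^ 2) x =
      -∑ i ∈ s, (2 * c i * ρ i x) • stdDiff (ρ i) x := by
  funext j
  have hl := (chartAt (Coord n) x).left_inv (mem_chart_source (Coord n) x)
  have hs : ContMDiff (𝓡 n) 𝓘(ℝ, ℝ) ∞ fun z => ∑ i ∈ s, c i * ρ i z ^ 2 :=
    ContMDiff.sum fun i _ => contMDiff_const.mul ((hρ i).pow 2)
  rw [stdDiff_apply_eq_sum (contMDiff_const.sub hs)]
  simp only [Pi.neg_apply, Finset.sum_apply, Pi.smul_apply, smul_eq_mul,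
    stdDiff_apply_eq_sum (hρ _), Finset.mul_sum]
  rw [Finset.sum_comm, ← Finset.sum_neg_distrib]
  refine Finset.sum_congr rfl fun a _ => ?_
  have hd := fun i => differentiableAt_comp_chart_symm (hρ i) x
  rw [pd_sub (differentiableAt_const _) (DifferentiableAt.fun_sum fun i _ =>
      ((hd i).fun_pow 2).const_mul (c i)),
    pd_sum (f := fun i z => c i * ρ i ((chartAt (Coord n) x).symm z) ^ 2)
      (fun i _ => ((hd i).fun_pow 2).const_mul (c i))]
  have h0 : pd a (fun _ : Coord n => (1 : ℝ)) (chartAt (Coord n) x x) = 0 := by simp [pd]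
  rw [h0, zero_sub, mul_neg, Finset.mul_sum]
  congr 1
  refine Finset.sum_congr rfl fun i _ => ?_
  rw [pd_const_mul ((hd i).fun_pow 2)]
  simp only [sq]
  rw [pd_mul (hd i) (hd i), hl]
  ring

theorem Metr.toBilin_nonneg (g : Metr n M) (x : M) (ξ : Fin n → ℝ) :
    0 ≤ Matrix.toBilin' (stdGram g.inner x)⁻¹ ξ ξ := by
  rw [Matrix.toBilin'_apply']
  have h := (stdGram_posDef (g.symm x) (g.pos x)).inv.posSemidef
  simpa using h.dotProduct_mulVec_nonneg ξ

theorem Metr.toBilin_symm (g : Metr n M) (x : M) (ξ η : Fin n → ℝ) :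
    Matrix.toBilin' (stdGram g.inner x)⁻¹ ξ η = Matrix.toBilin' (stdGram g.inner x)⁻¹ η ξ := by
  have h : ((stdGram g.inner x)⁻¹)ᵀ = (stdGram g.inner x)⁻¹ := by
    rw [Matrix.transpose_nonsing_inv]
    congr 1
    exact gram_transpose (g.symm x) _
  rw [Matrix.toBilin'_apply', Matrix.toBilin'_apply', dotProduct_comm, Matrix.dotProduct_mulVec,
    ← Matrix.mulVec_transpose, h]

theorem Metr.gradSq_nonneg (g : Metr n M) (v : M → ℝ) (x : M) : 0 ≤ gradSq g.inner v x := by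
  rw [gradSq_eq]; exact g.toBilin_nonneg x _

end Gradient

section Energy

open Matrix MeasureTheory

variable {n : ℕ} {M : Type*} [TopologicalSpace M] [ChartedSpace (Coord n) M]

/-! ### The Yamabe energy and the `Lᵖ`-norm -/

/-- The coefficient `aₙ = 4(n-1)/(n-2)`. -/
def yamabeCoeff (n : ℕ) : ℝ := 4 * ((n : ℝ) - 1) / ((n : ℝ) - 2)

theorem yamabeCoeff_nonneg (hn : 3 ≤ n) : 0 ≤ yamabeCoeff n := by
  have : (3 : ℝ) ≤ n := by exact_mod_cast hn
  exact div_nonneg (by linarith) (by linarith)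

/-- The integrand `aₙ |dv|_g² + scal_g v²` of the Yamabe energy. -/
def energyDensity (g : FormField n M) (v : M → ℝ) (x : M) : ℝ :=
  yamabeCoeff n * gradSq g v x + scal g x * v x ^ 2

/-- The Yamabe energy `∫ (aₙ |dv|_g² + scal_g v²) dμ_g`. -/
def energy [MeasurableSpace M] (g : FormField n M) (v : M → ℝ) : ℝ :=
  ∫ x, energyDensity g v x ∂riemVolume g

theorem yamabeFunctional_eq [MeasurableSpace M] (g : FormField n M) (v : M → ℝ) :
    yamabeFunctional g v = 1 / lpNorm g v ^ 2 * energy g v := rfl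

theorem hasCompactSupport_of_tsupport {X : Type*} [TopologicalSpace X] [R1Space X]
    {v f : X → ℝ} (hv : HasCompactSupport v)
    (hf : ∀ x, x ∉ tsupport v → f x = 0) : HasCompactSupport f :=
  HasCompactSupport.intro hv fun x hx => hf x hx

/-- The exponent `p = 2n/(n-2)`. -/
def yamabeExp (n : ℕ) : ℝ := 2 * (n : ℝ) / ((n : ℝ) - 2)

theorem two_le_yamabeExp (hn : 3 ≤ n) : 2 ≤ yamabeExp n := by
  have : (3 : ℝ) ≤ n := by exact_mod_cast hn
  rw [yamabeExp, le_div_iff₀ (by linarith)]; linarith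

theorem continuous_rpow_yamabeExp {X : Type*} [TopologicalSpace X]
    (hn : 3 ≤ n) {v : X → ℝ} (hv : Continuous v) :
    Continuous fun x => v x ^ yamabeExp n :=
  hv.rpow_const fun _ => Or.inr (by linarith [two_le_yamabeExp hn])

theorem hasCompactSupport_rpow {X : Type*} [TopologicalSpace X] [R1Space X] (hn : 3 ≤ n)
    {v : X → ℝ} (hc : HasCompactSupport v) :
    HasCompactSupport fun x => v x ^ yamabeExp n :=
  hasCompactSupport_of_tsupport hc fun x hx => by
    rw [image_eq_zero_of_notMem_tsupport hx,
      Real.zero_rpow (by linarith [two_le_yamabeExp hn])]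

theorem lpNorm_eq [MeasurableSpace M] (g : FormField n M) (v : M → ℝ) :
    lpNorm g v = (∫ x, v x ^ yamabeExp n ∂riemVolume g) ^ (1 / yamabeExp n) := rfl

theorem lpNorm_sq_eq [MeasurableSpace M] (g : FormField n M) {v : M → ℝ} (hv : ∀ x, 0 ≤ v x) :
    lpNorm g v ^ 2 = (∫ x, v x ^ yamabeExp n ∂riemVolume g) ^ (2 / yamabeExp n) := by
  rw [lpNorm_eq, ← Real.rpow_natCast, ← Real.rpow_mul
    (integral_nonneg fun x => Real.rpow_nonneg (hv x) _)]
  congr 1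
  push_cast
  ring

theorem lpNorm_nonneg [MeasurableSpace M] (g : FormField n M) {v : M → ℝ} (hv : ∀ x, 0 ≤ v x) :
    0 ≤ lpNorm g v :=
  Real.rpow_nonneg (integral_nonneg fun x => Real.rpow_nonneg (hv x) _) _

theorem lpNorm_const_mul [MeasurableSpace M] (hn : 3 ≤ n) (g : FormField n M) {v : M → ℝ}
    (h0 : ∀ x, 0 ≤ v x)
    {c : ℝ} (hc : 0 ≤ c) : lpNorm g (fun x => c * v x) = c * lpNorm g v := by
  have hp := two_le_yamabeExp hn
  have hp0 : yamabeExp n ≠ 0 := by linarith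
  rw [lpNorm_eq, lpNorm_eq]
  simp only [Real.mul_rpow hc (h0 _), integral_const_mul]
  rw [Real.mul_rpow (Real.rpow_nonneg hc _) (integral_nonneg fun x => Real.rpow_nonneg (h0 x) _),
    ← Real.rpow_mul hc, mul_one_div_cancel hp0, Real.rpow_one]

variable [IsManifold (𝓡 n) ∞ M] [T2Space M] [MeasurableSpace M] [BorelSpace M]

theorem Metr.integrable (g : Metr n M) {f : M → ℝ} (hf : Continuous f)
    (hc : HasCompactSupport f) : Integrable f (riemVolume g.inner) :=
  hf.integrable_of_hasCompactSupport hc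

theorem Metr.integrable_mul_gradSq (g : Metr n M) {v f : M → ℝ}
    (hv : ContMDiff (𝓡 n) 𝓘(ℝ, ℝ) ∞ v) (hc : HasCompactSupport v) (hf : Continuous f) :
    Integrable (fun x => f x * gradSq g.inner v x) (riemVolume g.inner) :=
  g.integrable (hf.mul (g.continuous_cotangentNormSq hv))
    (hasCompactSupport_of_tsupport hc fun x hx => by rw [gradSq_eq_zero _ hx, mul_zero])

theorem Metr.integrable_mul_sq (g : Metr n M) {v f : M → ℝ}
    (hv : Continuous v) (hc : HasCompactSupport v) (hf : Continuous f) :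
    Integrable (fun x => f x * v x ^ 2) (riemVolume g.inner) :=
  g.integrable (hf.mul (hv.pow 2))
    (hasCompactSupport_of_tsupport hc fun x hx => by
      rw [image_eq_zero_of_notMem_tsupport hx]; simp)

theorem Metr.integrable_energyDensity (g : Metr n M) {v : M → ℝ}
    (hv : ContMDiff (𝓡 n) 𝓘(ℝ, ℝ) ∞ v) (hc : HasCompactSupport v) :
    Integrable (energyDensity g.inner v) (riemVolume g.inner) :=
  (g.integrable_mul_gradSq hv hc continuous_const).add
    (g.integrable_mul_sq hv.continuous hc g.continuous_scal)

/-- The energies of two metrics that are close on the support of `v` are close. -/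
theorem abs_energy_sub_le (hn : 3 ≤ n) {g h : Metr n M} {κ κ₀ : M → ℝ} {v : M → ℝ}
    (hv : ContMDiff (𝓡 n) 𝓘(ℝ, ℝ) ∞ v) (hc : HasCompactSupport v)
    (hclose : ∀ x, CloseAt g.inner h.inner (κ₀ x) x) (hκ : Continuous κ)
    (hκκ : ∀ x ∈ tsupport v, κ₀ x ≤ κ x) (h0 : ∀ x, 0 ≤ κ₀ x) (h1 : ∀ x, κ₀ x ≤ 1) :
    |energy h.inner v - energy g.inner v| ≤
      ∫ x, κ x * (3 * yamabeCoeff n * gradSq g.inner v x + (|scal g.inner x| + 2) * v x ^ 2)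
        ∂riemVolume g.inner := by
  have hh : energy h.inner v =
      ∫ x, relDensity g.inner h.inner x * energyDensity h.inner v x ∂riemVolume g.inner :=
    integral_riemVolume g h _
  have hi1 : Integrable (fun x => relDensity g.inner h.inner x * energyDensity h.inner v x)
      (riemVolume g.inner) := by
    refine g.integrable ((continuous_relDensity g h).mul
      ((continuous_const.mul (h.continuous_cotangentNormSq hv)).add
        (h.continuous_scal.mul (hv.continuous.pow 2)))) ?_
    refine hasCompactSupport_of_tsupport hc fun x hx => ?_
    rw [energyDensity, gradSq_eq_zero _ hx, image_eq_zero_of_notMem_tsupport hx]; simp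
  rw [hh, energy, ← integral_sub hi1 (g.integrable_energyDensity hv hc)]
  refine (abs_integral_le_integral_abs).trans ?_
  refine integral_mono_of_nonneg (Filter.Eventually.of_forall fun x => abs_nonneg _) ?_
    (Filter.Eventually.of_forall fun x => ?_)
  · refine g.integrable (hκ.mul ((continuous_const.mul (g.continuous_cotangentNormSq hv)).add
      ((g.continuous_scal.abs.add continuous_const).mul (hv.continuous.pow 2)))) ?_
    refine hasCompactSupport_of_tsupport hc fun x hx => ?_
    rw [gradSq_eq_zero _ hx, image_eq_zero_of_notMem_tsupport hx]; simp
  · by_cases hx : x ∈ tsupport v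
    · have hb := (hclose x).gradSq_bounds v
      have h2 := abs_density_sub_le (yamabeCoeff_nonneg hn) (g.gradSq_nonneg v x)
        (sq_nonneg (v x)) (h0 x) (h1 x) hb.1 hb.2 (hclose x).scal.le (hclose x).density.le
      refine h2.trans (mul_le_mul_of_nonneg_right (hκκ x hx) ?_)
      have := mul_nonneg (yamabeCoeff_nonneg hn) (g.gradSq_nonneg v x)
      have := mul_nonneg (by positivity : 0 ≤ |scal g.inner x| + 2) (sq_nonneg (v x))
      linarith
    · simp only [energyDensity, gradSq_eq_zero _ hx, image_eq_zero_of_notMem_tsupport hx]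
      simp

theorem Metr.integrable_rpow (hn : 3 ≤ n) (g : Metr n M) {v : M → ℝ} (hv : Continuous v)
    (hc : HasCompactSupport v) :
    Integrable (fun x => v x ^ yamabeExp n) (riemVolume g.inner) :=
  g.integrable (continuous_rpow_yamabeExp hn hv) (hasCompactSupport_rpow hn hc)

theorem Metr.lpNorm_pos (hn : 3 ≤ n) (g : Metr n M) {v : M → ℝ} (hv : Continuous v)
    (hc : HasCompactSupport v) (h0 : ∀ x, 0 ≤ v x) (hne : v ≠ 0) : 0 < lpNorm g.inner v := by
  refine Real.rpow_pos_of_pos ?_ _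
  obtain ⟨x, hx⟩ := Function.ne_iff.1 hne
  refine (continuous_rpow_yamabeExp hn hv).integral_pos_of_hasCompactSupport_nonneg_nonzero
    (hasCompactSupport_rpow hn hc) (fun x => Real.rpow_nonneg (h0 x) _) (x := x) ?_
  exact (Real.rpow_pos_of_pos (lt_of_le_of_ne (h0 x) (Ne.symm hx)) _).ne'

theorem Metr.lpNorm_mono (hn : 3 ≤ n) (g : Metr n M) {u v : M → ℝ} (hv : Continuous v)
    (hc : HasCompactSupport v) (h0 : ∀ x, 0 ≤ u x) (huv : ∀ x, u x ≤ v x) :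
    lpNorm g.inner u ≤ lpNorm g.inner v := by
  have hp := two_le_yamabeExp hn
  rw [lpNorm_eq, lpNorm_eq]
  refine Real.rpow_le_rpow (integral_nonneg fun x => Real.rpow_nonneg (h0 x) _) ?_ (by
    exact one_div_nonneg.2 (by linarith : (0 : ℝ) ≤ yamabeExp n))
  exact integral_mono_of_nonneg (Filter.Eventually.of_forall fun x => Real.rpow_nonneg (h0 x) _)
    (g.integrable_rpow hn hv hc)
    (Filter.Eventually.of_forall fun x => Real.rpow_le_rpow (h0 x) (huv x) (by linarith))

/-- The `Lᵖ`-norms of two metrics whose volume densities are close are close. -/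
theorem lpNorm_sq_bounds (hn : 3 ≤ n) {g h : Metr n M} {δ : ℝ} (hδ0 : 0 ≤ δ) (hδ : δ ≤ 1)
    (hr : ∀ x, |relDensity g.inner h.inner x - 1| ≤ δ) {v : M → ℝ} (hv : Continuous v)
    (hc : HasCompactSupport v) (h0 : ∀ x, 0 ≤ v x) :
    (1 - δ) * lpNorm g.inner v ^ 2 ≤ lpNorm h.inner v ^ 2 ∧
      lpNorm h.inner v ^ 2 ≤ (1 + δ) * lpNorm g.inner v ^ 2 := by
  have hp := two_le_yamabeExp hn
  have hq0 : 0 ≤ 2 / yamabeExp n := by positivity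
  have hq1 : 2 / yamabeExp n ≤ 1 := by rw [div_le_one (by linarith)]; exact hp
  set I := ∫ x, v x ^ yamabeExp n ∂riemVolume g.inner with hI
  have hI0 : 0 ≤ I := integral_nonneg fun x => Real.rpow_nonneg (h0 x) _
  have hint : ∀ f : M → ℝ, Continuous f →
      Integrable (fun x => f x * v x ^ yamabeExp n) (riemVolume g.inner) := fun f hf =>
    g.integrable (hf.mul (continuous_rpow_yamabeExp hn hv)) (hasCompactSupport_rpow hn hc).mul_left
  have hlow : (1 - δ) * I ≤ ∫ x, v x ^ yamabeExp n ∂riemVolume h.inner := by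
    rw [integral_riemVolume g h, hI, ← integral_const_mul]
    refine integral_mono (hint _ continuous_const) (hint _ (continuous_relDensity g h)) fun x => ?_
    exact mul_le_mul_of_nonneg_right (by linarith [(abs_le.1 (hr x)).1])
      (Real.rpow_nonneg (h0 x) _)
  have hupp : ∫ x, v x ^ yamabeExp n ∂riemVolume h.inner ≤ (1 + δ) * I := by
    rw [integral_riemVolume g h, hI, ← integral_const_mul]
    refine integral_mono (hint _ (continuous_relDensity g h)) (hint _ continuous_const) fun x => ?_
    exact mul_le_mul_of_nonneg_right (by linarith [(abs_le.1 (hr x)).2])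
      (Real.rpow_nonneg (h0 x) _)
  rw [lpNorm_sq_eq _ h0, lpNorm_sq_eq _ h0, ← hI]
  constructor
  · calc (1 - δ) * I ^ (2 / yamabeExp n)
        ≤ (1 - δ) ^ (2 / yamabeExp n) * I ^ (2 / yamabeExp n) := by
          refine mul_le_mul_of_nonneg_right ?_ (Real.rpow_nonneg hI0 _)
          exact Real.self_le_rpow_of_le_one (by linarith) (by linarith) hq1
      _ = ((1 - δ) * I) ^ (2 / yamabeExp n) := (Real.mul_rpow (by linarith) hI0).symm
      _ ≤ _ := Real.rpow_le_rpow (mul_nonneg (by linarith) hI0) hlow hq0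
  · calc (∫ x, v x ^ yamabeExp n ∂riemVolume h.inner) ^ (2 / yamabeExp n)
        ≤ ((1 + δ) * I) ^ (2 / yamabeExp n) :=
          Real.rpow_le_rpow (integral_nonneg fun x => Real.rpow_nonneg (h0 x) _) hupp hq0
      _ = (1 + δ) ^ (2 / yamabeExp n) * I ^ (2 / yamabeExp n) := Real.mul_rpow (by linarith) hI0
      _ ≤ (1 + δ) * I ^ (2 / yamabeExp n) := by
          refine mul_le_mul_of_nonneg_right ?_ (Real.rpow_nonneg hI0 _)
          exact Real.rpow_le_self_of_one_le (by linarith) hq1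

/-- Hölder's inequality with exponents `n/2` and `n/(n-2)`. -/
theorem Metr.integral_mul_sq_le (hn : 3 ≤ n) (g : Metr n M) {f v : M → ℝ} (hf : Continuous f)
    (hfc : HasCompactSupport f) (hf0 : ∀ x, 0 ≤ f x) (hv : Continuous v)
    (hc : HasCompactSupport v) (h0 : ∀ x, 0 ≤ v x) :
    ∫ x, f x * v x ^ 2 ∂riemVolume g.inner ≤
      (∫ x, f x ^ ((n : ℝ) / 2) ∂riemVolume g.inner) ^ (1 / ((n : ℝ) / 2)) *
        lpNorm g.inner v ^ 2 := by
  have hn' : (3 : ℝ) ≤ n := by exact_mod_cast hn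
  have hpq : ((n : ℝ) / 2).HolderConjugate ((n : ℝ) / ((n : ℝ) - 2)) := by
    rw [Real.holderConjugate_iff]
    refine ⟨by linarith, ?_⟩
    have : (n : ℝ) - 2 ≠ 0 := by linarith
    field_simp
    ring
  have h1 := integral_mul_le_Lp_mul_Lq_of_nonneg (μ := riemVolume g.inner) hpq
    (f := f) (g := fun x => v x ^ 2) (Filter.Eventually.of_forall hf0)
    (Filter.Eventually.of_forall fun x => sq_nonneg _)
    (hf.memLp_of_hasCompactSupport hfc)
    ((hv.pow 2).memLp_of_hasCompactSupport (hasCompactSupport_of_tsupport hc fun x hx => by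
      rw [Pi.pow_apply, image_eq_zero_of_notMem_tsupport hx]; simp))
  refine h1.trans (le_of_eq ?_)
  rw [lpNorm_sq_eq _ h0]
  congr 1
  have h2 : ∀ x, (v x ^ 2) ^ ((n : ℝ) / ((n : ℝ) - 2)) = v x ^ yamabeExp n := by
    intro x
    rw [← Real.rpow_natCast, ← Real.rpow_mul (h0 x), yamabeExp]
    congr 1
    push_cast
    ring
  simp only [h2]
  congr 1
  rw [yamabeExp]
  have : (n : ℝ) - 2 ≠ 0 := by linarith
  field_simp

end Energy

section Localization

open Matrix MeasureTheory

variable {n : ℕ} {M : Type*} [TopologicalSpace M] [ChartedSpace (Coord n) M]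

/-! ### Localization of the energy -/

variable (n M) in
/-- A locally finite sequence of compactly supported smooth functions `M → [0, 1]` without common
zeros. -/
structure CutoffFamily where
  /-- The functions of the family. -/
  toFun : ℕ → M → ℝ
  smooth : ∀ i, ContMDiff (𝓡 n) 𝓘(ℝ, ℝ) ∞ (toFun i)
  hasCompactSupport : ∀ i, HasCompactSupport (toFun i)
  nonneg : ∀ i x, 0 ≤ toFun i x
  le_one : ∀ i x, toFun i x ≤ 1
  locallyFinite : LocallyFinite fun i => Function.support (toFun i)
  exists_pos : ∀ x, ∃ i, 0 < toFun i x

/-- A partition of unity subordinate to the interiors of a compact exhaustion is a cutoff family. -/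
theorem exists_cutoffFamily [IsManifold (𝓡 n) ∞ M] [T2Space M] [SecondCountableTopology M] :
    Nonempty (CutoffFamily n M) := by
  have : LocallyCompactSpace M := ChartedSpace.locallyCompactSpace (Coord n) M
  let K := CompactExhaustion.choice M
  obtain ⟨f, hf⟩ := SmoothPartitionOfUnity.exists_isSubordinate (𝓡 n) (s := (Set.univ : Set M))
    isClosed_univ (fun i => interior (K (i + 1))) (fun i => isOpen_interior) (by
      intro x _
      obtain ⟨i, hi⟩ := K.exists_mem x
      exact Set.mem_iUnion.2 ⟨i, K.subset_interior_succ i hi⟩)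
  exact ⟨
    { toFun := fun i => f i
      smooth := fun i => (f i).contMDiff
      hasCompactSupport := fun i => (K.isCompact (i + 1)).of_isClosed_subset (isClosed_tsupport _)
        ((hf i).trans interior_subset)
      nonneg := f.nonneg
      le_one := f.le_one
      locallyFinite := f.locallyFinite
      exists_pos := fun x => f.exists_pos_of_mem (Set.mem_univ x) }⟩

namespace CutoffFamily

variable (ρ : CutoffFamily n M)

/-- The function `κ = ∑ cᵢ ρᵢ²`, restricted to a finite set of indices. -/
def partialSum (c : ℕ → ℝ) (s : Finset ℕ) (x : M) : ℝ := ∑ i ∈ s, c i * ρ.toFun i x ^ 2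

/-- The weights `8 aₙ |dρᵢ|_g² + (3 |scal_g| + 2) ρᵢ²` which bound the localization error. -/
def weight (g : FormField n M) (i : ℕ) (x : M) : ℝ :=
  8 * yamabeCoeff n * gradSq g (ρ.toFun i) x + (3 * |scal g x| + 2) * ρ.toFun i x ^ 2

theorem contMDiff_partialSum (c : ℕ → ℝ) (s : Finset ℕ) :
    ContMDiff (𝓡 n) 𝓘(ℝ, ℝ) ∞ (ρ.partialSum c s) :=
  ContMDiff.sum fun i _ => contMDiff_const.mul ((ρ.smooth i).pow 2)

theorem partialSum_nonneg {c : ℕ → ℝ} (hc : ∀ i, 0 ≤ c i) (s : Finset ℕ) (x : M) :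
    0 ≤ ρ.partialSum c s x :=
  Finset.sum_nonneg fun i _ => mul_nonneg (hc i) (sq_nonneg _)

theorem partialSum_le {c : ℕ → ℝ} (hc : ∀ i, 0 ≤ c i) {δ : ℝ} (s : Finset ℕ)
    (hδ : ∑ i ∈ s, c i ≤ δ) (x : M) : ρ.partialSum c s x ≤ δ := by
  refine le_trans (Finset.sum_le_sum fun i _ => ?_) hδ
  have h1 : ρ.toFun i x ^ 2 ≤ 1 := pow_le_one₀ (ρ.nonneg i x) (ρ.le_one i x)
  nlinarith [mul_le_mul_of_nonneg_left h1 (hc i)]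

/-- The Hölder constants of the weights. -/
def weightConst [MeasurableSpace M] (g : FormField n M) (i : ℕ) : ℝ :=
  (∫ x, ρ.weight g i x ^ ((n : ℝ) / 2) ∂riemVolume g) ^ (1 / ((n : ℝ) / 2))

variable [IsManifold (𝓡 n) ∞ M]

theorem weight_nonneg (hn : 3 ≤ n) (g : Metr n M) (i : ℕ) (x : M) : 0 ≤ ρ.weight g.inner i x := by
  have h1 := mul_nonneg (yamabeCoeff_nonneg hn) (g.gradSq_nonneg (ρ.toFun i) x)
  have h2 : 0 ≤ (3 * |scal g.inner x| + 2) * ρ.toFun i x ^ 2 := by positivity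
  unfold weight
  nlinarith

theorem continuous_weight (g : Metr n M) (i : ℕ) : Continuous (ρ.weight g.inner i) :=
  (continuous_const.mul (g.continuous_cotangentNormSq (ρ.smooth i))).add
    (((continuous_const.mul g.continuous_scal.abs).add continuous_const).mul
      ((ρ.smooth i).continuous.pow 2))

theorem hasCompactSupport_weight [T2Space M] (g : Metr n M) (i : ℕ) :
    HasCompactSupport (ρ.weight g.inner i) :=
  hasCompactSupport_of_tsupport (ρ.hasCompactSupport i) fun x hx => by
    rw [weight, gradSq_eq_zero _ hx, image_eq_zero_of_notMem_tsupport hx]; simp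

/-- The pointwise form of the localization inequality. -/
theorem energyDensity_localization (hn : 3 ≤ n) (g : Metr n M) {c : ℕ → ℝ} (hc : ∀ i, 0 ≤ c i)
    {s : Finset ℕ} (hs : ∑ i ∈ s, c i ≤ 1) {v : M → ℝ} (hv : ContMDiff (𝓡 n) 𝓘(ℝ, ℝ) ∞ v)
    (x : M) :
    energyDensity g.inner (fun z => (1 - ρ.partialSum c s z) * v z) x +
        ρ.partialSum c s x / 3 * (3 * yamabeCoeff n * gradSq g.inner v x +
          (|scal g.inner x| + 2) * v x ^ 2) ≤
      energyDensity g.inner v x + ∑ i ∈ s, c i * (ρ.weight g.inner i x * v x ^ 2) := by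
  set κ := ρ.partialSum c s x with hκ
  have hκ0 : 0 ≤ κ := ρ.partialSum_nonneg hc s x
  have hκ1 : κ ≤ 1 := ρ.partialSum_le hc s hs x
  set T := ∑ i ∈ s, c i * gradSq g.inner (ρ.toFun i) x with hT
  have ha := yamabeCoeff_nonneg hn
  have hgrad : gradSq g.inner (fun z => (1 - ρ.partialSum c s z) * v z) x ≤
      (1 - κ) * gradSq g.inner v x + 8 * v x ^ 2 * T := by
    have h1 : stdDiff (n := n) (fun z => (1 - ρ.partialSum c s z) * v z) x =
        (1 - κ) • stdDiff v x -
          v x • ∑ i ∈ s, (2 * c i * ρ.toFun i x) • stdDiff (ρ.toFun i) x := by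
      rw [stdDiff_mul (contMDiff_const.sub (ρ.contMDiff_partialSum c s)) hv]
      have h2 := stdDiff_one_sub_sum_sq (n := n) s c ρ.smooth x
      have h3 : stdDiff (n := n) (fun z => 1 - ρ.partialSum c s z) x =
        -∑ i ∈ s, (2 * c i * ρ.toFun i x) • stdDiff (ρ.toFun i) x := h2
      rw [h3, smul_neg, ← sub_eq_add_neg]
    simp only [gradSq_eq, h1, hT]
    exact bilin_localization _ (g.toBilin_nonneg x) (g.toBilin_symm x) s hc _ _ _ hκ1
  have hW : ∑ i ∈ s, c i * (ρ.weight g.inner i x * v x ^ 2) =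
      (8 * yamabeCoeff n * T + (3 * |scal g.inner x| + 2) * κ) * v x ^ 2 := by
    simp only [hT, hκ, partialSum, weight, Finset.mul_sum]
    rw [← Finset.sum_add_distrib, Finset.sum_mul]
    exact Finset.sum_congr rfl fun i _ => by ring
  have hS : scal g.inner x * ((1 - κ) * v x) ^ 2 ≤
      scal g.inner x * v x ^ 2 + 2 * κ * |scal g.inner x| * v x ^ 2 := by
    have h1 : scal g.inner x * ((1 - κ) ^ 2 - 1) ≤ 2 * κ * |scal g.inner x| := by
      have h2 := neg_abs_le (scal g.inner x)
      have h3 : 0 ≤ κ * (2 - κ) := mul_nonneg hκ0 (by linarith)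
      nlinarith [mul_le_mul_of_nonneg_left h2 h3,
        mul_nonneg (sq_nonneg κ) (abs_nonneg (scal g.inner x))]
    nlinarith [mul_le_mul_of_nonneg_right h1 (sq_nonneg (v x))]
  rw [hW]
  simp only [energyDensity]
  have h5 := mul_le_mul_of_nonneg_left hgrad ha
  have h6 : 0 ≤ κ * |scal g.inner x| * v x ^ 2 := by positivity
  have h7 : 0 ≤ κ * v x ^ 2 := by positivity
  rw [← hκ]
  nlinarith

theorem weightConst_nonneg [MeasurableSpace M] (hn : 3 ≤ n) (g : Metr n M) (i : ℕ) :
    0 ≤ ρ.weightConst g.inner i :=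
  Real.rpow_nonneg (integral_nonneg fun x => Real.rpow_nonneg (ρ.weight_nonneg hn g i x) _) _

variable [T2Space M] [MeasurableSpace M] [BorelSpace M]

/-- The energy of `v` bounds the energy of the localized function `(1 - κ) v` plus a weighted
Dirichlet energy of `v`, up to an error that is controlled by the `Lᵖ`-norm of `v`. -/
theorem energy_localization (hn : 3 ≤ n) (g : Metr n M) {c : ℕ → ℝ} (hc : ∀ i, 0 ≤ c i)
    {s : Finset ℕ} (hs : ∑ i ∈ s, c i ≤ 1) {v : M → ℝ} (hv : ContMDiff (𝓡 n) 𝓘(ℝ, ℝ) ∞ v)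
    (hvc : HasCompactSupport v) (hv0 : ∀ x, 0 ≤ v x) :
    energy g.inner (fun z => (1 - ρ.partialSum c s z) * v z) +
        ∫ x, ρ.partialSum c s x / 3 * (3 * yamabeCoeff n * gradSq g.inner v x +
          (|scal g.inner x| + 2) * v x ^ 2) ∂riemVolume g.inner ≤
      energy g.inner v + (∑ i ∈ s, c i * ρ.weightConst g.inner i) * lpNorm g.inner v ^ 2 := by
  have hw : ContMDiff (𝓡 n) 𝓘(ℝ, ℝ) ∞ (fun z => (1 - ρ.partialSum c s z) * v z) :=
    (contMDiff_const.sub (ρ.contMDiff_partialSum c s)).mul hv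
  have hi1 := g.integrable_energyDensity hw hvc.mul_left
  have hi2 := g.integrable_energyDensity hv hvc
  have hi3 : Integrable (fun x => ρ.partialSum c s x / 3 * (3 * yamabeCoeff n * gradSq g.inner v x +
      (|scal g.inner x| + 2) * v x ^ 2)) (riemVolume g.inner) := by
    refine g.integrable ((((ρ.contMDiff_partialSum c s).continuous).div_const 3).mul
      ((continuous_const.mul (g.continuous_cotangentNormSq hv)).add
      ((g.continuous_scal.abs.add continuous_const).mul (hv.continuous.pow 2)))) ?_
    refine hasCompactSupport_of_tsupport hvc fun x hx => ?_
    rw [gradSq_eq_zero _ hx, image_eq_zero_of_notMem_tsupport hx]; simp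
  have hi4 : ∀ i ∈ s, Integrable (fun x => c i * (ρ.weight g.inner i x * v x ^ 2))
      (riemVolume g.inner) := fun i _ =>
    (g.integrable_mul_sq hv.continuous hvc (ρ.continuous_weight g i)).const_mul _
  have hmain := integral_mono (hi1.add hi3) (hi2.add (integrable_finsetSum s hi4))
    fun x => ρ.energyDensity_localization hn g hc hs hv x
  simp only [Pi.add_apply] at hmain
  rw [integral_add hi1 hi3, integral_add hi2 (integrable_finsetSum s hi4),
    integral_finsetSum s hi4] at hmain
  refine hmain.trans (add_le_add le_rfl ?_)
  rw [Finset.sum_mul]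
  refine Finset.sum_le_sum fun i _ => ?_
  rw [integral_const_mul, mul_assoc]
  exact mul_le_mul_of_nonneg_left (g.integral_mul_sq_le hn (ρ.continuous_weight g i)
    (ρ.hasCompactSupport_weight g i) (ρ.weight_nonneg hn g i) hv.continuous hvc hv0) (hc i)

end CutoffFamily

end Localization

section Continuity

open MeasureTheory

variable {n : ℕ} {M : Type*} [TopologicalSpace M] [ChartedSpace (Coord n) M]
  [IsManifold (𝓡 n) ∞ M] [T2Space M] [MeasurableSpace M] [BorelSpace M]

/-! ### Semicontinuity of the Yamabe map -/

/-- Lower bounds of the quotient without division, using that the `Lᵖ`-norm of a test function is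
positive. -/
theorem le_yamabeFunctional_iff (hn : 3 ≤ n) (g : Metr n M) (v : TestFun n M) (c : ℝ) :
    c ≤ yamabeFunctional g.inner v.1 ↔ c * lpNorm g.inner v.1 ^ 2 ≤ energy g.inner v.1 := by
  have h := pow_pos (g.lpNorm_pos hn v.2.1.continuous v.2.2.1 v.2.2.2.1 v.2.2.2.2) 2
  rw [yamabeFunctional_eq, one_div, inv_mul_eq_div, le_div_iff₀ h]

/-- A bound `Q_h(v) < c` persists for metrics near `g`, for a fixed test function `v`. -/
theorem eventually_yamabeFunctional_lt (hn : 3 ≤ n) (g : Metr n M) (v : TestFun n M) {c : ℝ}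
    (hvc : yamabeFunctional g.inner v.1 < c) :
    ∀ᶠ h in @nhds (Metr n M) (fineC2Topology n M) g, yamabeFunctional h.inner v.1 < c := by
  obtain ⟨v, hv, hc, h0, hne⟩ := v
  set N := lpNorm g.inner v ^ 2 with hN
  set D := ∫ x, (3 * yamabeCoeff n * gradSq g.inner v x + (|scal g.inner x| + 2) * v x ^ 2)
    ∂riemVolume g.inner with hD
  have hE : energy g.inner v < c * N := by
    by_contra! hle
    exact absurd ((le_yamabeFunctional_iff hn g ⟨v, hv, hc, h0, hne⟩ c).2 hle) (not_le.2 hvc)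
  have hN0 : 0 ≤ N := sq_nonneg _
  have hD0 : 0 ≤ D := integral_nonneg fun x => by
    have h1 := mul_nonneg (yamabeCoeff_nonneg hn) (g.gradSq_nonneg v x)
    have h2 : 0 ≤ (|scal g.inner x| + 2) * v x ^ 2 := by positivity
    change 0 ≤ 3 * yamabeCoeff n * gradSq g.inner v x + (|scal g.inner x| + 2) * v x ^ 2
    linarith
  -- `δ (D + |c| N)` has to be smaller than the gap `c N - E_g(v)`
  set δ : ℝ := min 1 ((c * N - energy g.inner v) / (D + |c| * N + 1)) with hδ
  have hden : 0 < D + |c| * N + 1 := by positivity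
  have hδ0 : 0 < δ := lt_min one_pos (div_pos (by linarith) hden)
  have hδ1 : δ ≤ 1 := min_le_left _ _
  have hδ2 : δ * (D + |c| * N + 1) ≤ c * N - energy g.inner v :=
    (le_div_iff₀ hden).1 (min_le_right _ _)
  filter_upwards [eventually_closeAt g (κ := fun _ => δ) continuous_const fun _ => hδ0] with h hh
  have h1 := abs_energy_sub_le hn hv hc hh (κ := fun _ => δ) continuous_const
    (fun _ _ => le_rfl) (fun _ => hδ0.le) (fun _ => hδ1)
  rw [integral_const_mul, ← hD] at h1
  have h2 := lpNorm_sq_bounds hn hδ0.le hδ1 (fun x => (hh x).density.le) hv.continuous hc h0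
  rw [← hN] at h2
  by_contra! hle
  have h3 := (le_yamabeFunctional_iff hn h ⟨v, hv, hc, h0, hne⟩ c).1 hle
  have h4 : c * N - |c| * (δ * N) ≤ c * lpNorm h.inner v ^ 2 := by
    have h5 : |lpNorm h.inner v ^ 2 - N| ≤ δ * N :=
      abs_le.2 ⟨by linarith [h2.1], by linarith [h2.2]⟩
    have h6 := neg_abs_le (c * (lpNorm h.inner v ^ 2 - N))
    rw [abs_mul] at h6
    nlinarith [mul_le_mul_of_nonneg_left h5 (abs_nonneg c)]
  have h5 := (abs_le.1 h1).2
  simp only at h3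
  nlinarith

/-- A lower bound of the Yamabe functional of `g` persists, with an arbitrarily small loss, for
metrics near `g` in the fine topology, uniformly over all test functions. -/
theorem eventually_le_yamabeFunctional [SecondCountableTopology M] (hn : 3 ≤ n) (g : Metr n M)
    {c y : ℝ} (hcy : c < y) (hy : ∀ v : TestFun n M, y ≤ yamabeFunctional g.inner v.1) :
    ∀ᶠ h in @nhds (Metr n M) (fineC2Topology n M) g,
      ∀ v : TestFun n M, c ≤ yamabeFunctional h.inner v.1 := by
  obtain ⟨ρ⟩ := exists_cutoffFamily (n := n) (M := M)
  -- the final loss will be `δ (2 |y| + |c| + 1)`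
  set δ : ℝ := min (1 / 2) ((y - c) / (2 * |y| + |c| + 1)) with hδ
  have hden : 0 < 2 * |y| + |c| + 1 := by positivity
  have hδ0 : 0 < δ := lt_min (by norm_num) (div_pos (by linarith) hden)
  have hδ1 : δ ≤ 1 / 2 := min_le_left _ _
  have hδ2 : δ * (2 * |y| + |c| + 1) ≤ y - c := (le_div_iff₀ hden).1 (min_le_right _ _)
  -- coefficients such that the sums of the `cᵢ` and of the Hölder constants are at most `δ`
  set b : ℕ → ℝ := fun i => δ * (1 / 2) ^ (i + 1) / (1 + ρ.weightConst g.inner i) with hb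
  have hw0 := ρ.weightConst_nonneg hn g
  have hb0 : ∀ i, 0 < b i := fun i => div_pos (by positivity) (by linarith [hw0 i])
  have hgeom : ∀ s : Finset ℕ, ∑ i ∈ s, δ * (1 / 2 : ℝ) ^ (i + 1) ≤ δ := by
    intro s
    rw [← Finset.mul_sum]
    have h1 : HasSum (fun i : ℕ => (1 / 2 : ℝ) ^ (i + 1)) 1 := by
      have := hasSum_geometric_two' (1 : ℝ)
      convert this using 2 with i
      rw [pow_succ]; simp; ring
    have h2 := h1.summable.sum_le_tsum s (fun i _ => by positivity)
    rw [h1.tsum_eq] at h2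
    nlinarith
  have hbs : ∀ s : Finset ℕ, ∑ i ∈ s, b i ≤ δ := fun s =>
    (Finset.sum_le_sum fun i _ => div_le_self (by positivity) (by linarith [hw0 i])).trans (hgeom s)
  have hbw : ∀ s : Finset ℕ, ∑ i ∈ s, b i * ρ.weightConst g.inner i ≤ δ := fun s => by
    refine (Finset.sum_le_sum fun i _ => ?_).trans (hgeom s)
    rw [hb, div_mul_eq_mul_div, div_le_iff₀ (by linarith [hw0 i])]
    have : 0 < δ * (1 / 2 : ℝ) ^ (i + 1) := by positivity
    nlinarith [hw0 i]
  -- `κ₀` is the positive continuous function that prescribes the neighbourhood of `g`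
  set κ₀ : M → ℝ := fun x => (∑ᶠ i, b i * ρ.toFun i x ^ 2) / 3 with hκ₀
  have hlf : LocallyFinite fun i => Function.support fun x => b i * ρ.toFun i x ^ 2 :=
    ρ.locallyFinite.subset fun i x hx => by
      simp only [Function.mem_support] at hx ⊢
      intro h0
      exact hx (by rw [h0]; simp)
  have hκc : Continuous κ₀ :=
    (continuous_finsum (fun i => continuous_const.mul ((ρ.smooth i).continuous.pow 2))
      hlf).div_const 3
  have hfin : ∀ x, (Function.support fun i => b i * ρ.toFun i x ^ 2).Finite := fun x =>
    hlf.point_finite x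
  have hκeq : ∀ x (s : Finset ℕ), (∀ i, ρ.toFun i x ≠ 0 → i ∈ s) →
      κ₀ x = ρ.partialSum b s x / 3 := by
    intro x s hs
    simp only [hκ₀, CutoffFamily.partialSum]
    rw [finsum_eq_sum_of_support_subset]
    intro i hi
    refine hs i fun h0 => hi ?_
    simp [h0]
  have hκpos : ∀ x, 0 < κ₀ x := by
    intro x
    refine div_pos ?_ (by norm_num)
    obtain ⟨i, hi⟩ := ρ.exists_pos x
    exact finsum_pos (fun j => mul_nonneg (hb0 j).le (sq_nonneg _))
      ⟨i, mul_pos (hb0 i) (pow_pos hi 2)⟩ (hfin x)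
  have hκδ : ∀ x, κ₀ x ≤ δ := by
    intro x
    have hf : {i | ρ.toFun i x ≠ 0}.Finite := ρ.locallyFinite.point_finite x
    rw [hκeq x hf.toFinset fun i hi => hf.mem_toFinset.2 hi]
    have := ρ.partialSum_le (fun i => (hb0 i).le) hf.toFinset (hbs _) x
    linarith
  filter_upwards [eventually_closeAt g hκc hκpos] with h hh v
  rw [le_yamabeFunctional_iff hn h]
  obtain ⟨v, hv, hc, h0, hne⟩ := v
  simp only
  -- only finitely many cutoff functions meet the support of `v`
  have hsfin := ρ.locallyFinite.finite_nonempty_inter_compact hc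
  set s := hsfin.toFinset with hs
  have hκs : ∀ x ∈ tsupport v, κ₀ x = ρ.partialSum b s x / 3 := fun x hx =>
    hκeq x s fun i hi => hsfin.mem_toFinset.2 ⟨x, hi, hx⟩
  have hb0' : ∀ i, 0 ≤ b i := fun i => (hb0 i).le
  set N := lpNorm g.inner v ^ 2 with hN
  have hN0 : 0 ≤ N := sq_nonneg _
  have h1 := (abs_le.1 (abs_energy_sub_le hn hv hc hh
    (κ := fun x => ρ.partialSum b s x / 3)
    ((ρ.contMDiff_partialSum b s).continuous.div_const 3) (fun x hx => (hκs x hx).le)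
    (fun x => (hκpos x).le) (fun x => (hκδ x).trans (by linarith)))).1
  have h2 := ρ.energy_localization hn g hb0' ((hbs s).trans (by linarith)) hv hc h0
  have h3 := lpNorm_sq_bounds hn hδ0.le (by linarith) (fun x => (hh x).density.le.trans (hκδ x))
    hv.continuous hc h0
  rw [← hN] at h2 h3
  -- the localized function is a test function
  set w : M → ℝ := fun z => (1 - ρ.partialSum b s z) * v z with hw
  have hκle : ∀ x, ρ.partialSum b s x ≤ δ := fun x => ρ.partialSum_le hb0' s (hbs s) x
  have hκge : ∀ x, 0 ≤ ρ.partialSum b s x := fun x => ρ.partialSum_nonneg hb0' s x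
  have hwge : ∀ x, (1 - δ) * v x ≤ w x := fun x =>
    mul_le_mul_of_nonneg_right (by linarith [hκle x]) (h0 x)
  have hwle : ∀ x, w x ≤ v x := fun x =>
    mul_le_of_le_one_left (h0 x) (by linarith [hκge x])
  have hδv : ∀ x, 0 ≤ (1 - δ) * v x := fun x => mul_nonneg (by linarith) (h0 x)
  have hw0' : ∀ x, 0 ≤ w x := fun x => (hδv x).trans (hwge x)
  have hwne : w ≠ 0 := by
    obtain ⟨x, hx⟩ := Function.ne_iff.1 hne
    refine Function.ne_iff.2 ⟨x, ?_⟩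
    have hx' : 0 < v x := lt_of_le_of_ne (h0 x) (Ne.symm hx)
    have : 0 < (1 - δ) * v x := mul_pos (by linarith) hx'
    exact (this.trans_le (hwge x)).ne'
  have hws : ContMDiff (𝓡 n) 𝓘(ℝ, ℝ) ∞ w :=
    (contMDiff_const.sub (ρ.contMDiff_partialSum b s)).mul hv
  have hwc : HasCompactSupport w := hc.mul_left
  have h4 := (le_yamabeFunctional_iff hn g ⟨w, hws, hwc, hw0', hwne⟩ y).1 (hy _)
  simp only at h4
  have h5 : lpNorm g.inner w ^ 2 ≤ N :=
    pow_le_pow_left₀ (lpNorm_nonneg g.inner hw0')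
      (g.lpNorm_mono hn hv.continuous hc hw0' hwle) 2
  have h6 : (1 - 2 * δ) * N ≤ lpNorm g.inner w ^ 2 := by
    have h7 := g.lpNorm_mono hn hws.continuous hwc hδv hwge
    rw [lpNorm_const_mul hn g.inner h0 (by linarith : 0 ≤ 1 - δ)] at h7
    have h8 := pow_le_pow_left₀ (mul_nonneg (by linarith) (lpNorm_nonneg g.inner h0)) h7 2
    rw [mul_pow, ← hN] at h8
    nlinarith [mul_nonneg (sq_nonneg δ) hN0]
  have h7 : y * N - |y| * (2 * δ * N) ≤ y * lpNorm g.inner w ^ 2 := by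
    have h8 : |lpNorm g.inner w ^ 2 - N| ≤ 2 * δ * N :=
      abs_le.2 ⟨by linarith, by nlinarith [mul_nonneg hδ0.le hN0]⟩
    have h9 := neg_abs_le (y * (lpNorm g.inner w ^ 2 - N))
    rw [abs_mul] at h9
    nlinarith [mul_le_mul_of_nonneg_left h8 (abs_nonneg y)]
  have h8 : c * lpNorm h.inner v ^ 2 ≤ c * N + |c| * (δ * N) := by
    have h9 : |lpNorm h.inner v ^ 2 - N| ≤ δ * N :=
      abs_le.2 ⟨by linarith [h3.1], by linarith [h3.2]⟩
    have h10 := le_abs_self (c * (lpNorm h.inner v ^ 2 - N))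
    rw [abs_mul] at h10
    nlinarith [mul_le_mul_of_nonneg_left h9 (abs_nonneg c)]
  have h9 := mul_le_mul_of_nonneg_right (hbw s) hN0
  have h10 := mul_le_mul_of_nonneg_right hδ2 hN0
  nlinarith

/-- Lower semicontinuity. Nothing has to be shown at metrics with Yamabe constant `-∞`. -/
theorem lowerSemicontinuous_yamabe [SecondCountableTopology M] (hn : 3 ≤ n) :
    let _ := fineC2Topology n M
    LowerSemicontinuous (yamabe : Metr n M → EReal) := by
  intro _ g c hc
  obtain ⟨a, hca, hag⟩ := EReal.lt_iff_exists_real_btwn.1 hc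
  obtain ⟨b, hab, hbg⟩ := EReal.lt_iff_exists_real_btwn.1 hag
  filter_upwards [eventually_le_yamabeFunctional hn g (EReal.coe_lt_coe_iff.1 hab) fun v =>
    EReal.coe_le_coe_iff.1 (hbg.le.trans (iInf_le _ v))] with h hh
  exact hca.trans_le (le_iInf fun v => EReal.coe_le_coe_iff.2 (hh v))

/-- Upper semicontinuity, as for every infimum of upper semicontinuous functions. -/
theorem upperSemicontinuous_yamabe (hn : 3 ≤ n) :
    let _ := fineC2Topology n M
    UpperSemicontinuous (yamabe : Metr n M → EReal) := by
  intro _ g c hc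
  obtain ⟨a, hga, hac⟩ := EReal.lt_iff_exists_real_btwn.1 hc
  obtain ⟨v, hv⟩ := iInf_lt_iff.1 hga
  filter_upwards [eventually_yamabeFunctional_lt hn g v (EReal.coe_lt_coe_iff.1 hv)] with h hh
  exact ((iInf_le _ v).trans_lt (EReal.coe_lt_coe_iff.2 hh)).trans hac

end Continuity
end Yamabe

end

theorem mainTheorem1 (n : ℕ) (hn : 3 ≤ n)
    (M : Type*) [TopologicalSpace M] [T2Space M] [SecondCountableTopology M] [Nonempty M]
    [ChartedSpace (EuclideanSpace ℝ (Fin n)) M] [IsManifold (𝓡 n) ∞ M]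
    [MeasurableSpace M] [BorelSpace M] :
    Continuous[Yamabe.fineC2Topology n M, inferInstance]
      (Yamabe.yamabe : Yamabe.Metr n M → EReal) := by
  let _ := Yamabe.fineC2Topology n M
  exact continuous_iff_lower_upperSemicontinuous.2
    ⟨Yamabe.lowerSemicontinuous_yamabe hn, Yamabe.upperSemicontinuous_yamabe hn⟩
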